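/- Let $H$ be a finite graph with at least one edge. Write $v_F,e_F$ for the numbers of vertices and edges of a graph $F$, and put $m_H:=\max_{F\subseteq H,\,v_F\ge1}e_F/v_F$. A subgraph $F\subseteq H$ with $v_F\ge 1$ is called primal if $e_F/v_F=m_H$; a subgraph $J$ of $H$ covers a primal $G$ if $G\subsetneq J$ and there is no primal $F$ with $G\subsetneq F\subsetneq J$. For $p\in[0,1]$ and any finite graph $F$, let $X_F$ be the number of copies of $F$ (subgraphs isomorphic to $F$) in the binomial random graph $G_{n,p}$, and let $\mu_F:=\mathbb E X_F$ and $\sigma_F:=\sqrt{\operatorname{Var}X_F}$. Let $$\Phi_H:=\min_{F\subseteq H,\,e_F\ge1}\mu_F,\qquad M_H:=\begin{cases}\min_{F\subseteq H,\,e_F\ge1}\mu_F^{1/\alpha^*_F}&\text{if }p<n^{-1/\Delta_H},\\ n^2p^{\Delta_H}&\text{if }p\ge n^{-1/\Delta_H},\end{cases}$$ where $\Delta_H$ is the maximum degree of $H$ and $\alpha_F^*$ is the fractional independence number of $F$, i.e. the maximum of $\sum_{v\in V(F)}f(v)$ over all $f:V(F)\to[0,1]$ with $f(u)+f(v)\le1$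 for every edge $uv$ of $F$. All asymptotics are as $n\to\infty$; $a_n\ll b_n$ means $a_n=o(b_n)$, and $a_n\gg1$ means $a_n\to\infty$. **Theorem 3.1.** Suppose that there are a primal subgraph $G$ of $H$, an integer $r\ge1$ and distinct primal subgraphs $J_1,\dots,J_r$ of $H$, each covering $G$, such that $K:=J_1\cup\dots\cup J_r$ satisfies $v_K/r<\min\{v_F: F\subseteq H\text{ primal}\}$. Then there are constants $c_H,\beta_H>0$ depending only on $H$ such that the following holds. (a) For every fixed $\varepsilon>0$ and every sequence $p=p(n)\in[0,1]$ with $1\ll np^{m_H}\ll(\log n)^{c_H}$, the probability below is positive for all large $n$, and $$-\log\mathbb P\bigl(X_H\ge(1+\varepsilon)\mathbb E X_H\bigr)=o\bigl(\min\{\Phi_H,\;M_H\log(1/p)\}\bigr).$$ (b) There is a function $\lambda=\lambda(n,p,H)$ such that for every sequence $p=p(n)\in[0,1]$ with $1\ll np^{m_H}\ll n^{\beta_H}$ we have $\lambda\gg1$ and $\lambda\sigma_H\ll\mu_H$, and for every sequence $t=t(n)$ with $\lambda\sigma_H\le t$ for all large $n$ and $t=O(\mu_H)$, the probability below is positive for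 all large $n$, and $$-\log\mathbb P\bigl(X_H\ge\mathbb E X_H+t\bigr)=o\bigl(t^2/\sigma_H^2\bigr).$$ -/

import Mathlib

open Filter Asymptotics MeasureTheory ProbabilityTheory
open scoped Topology unitInterval

namespace UpperTail

universe u

/-- `X_H`: the number of (not necessarily induced, unlabelled) copies of `H`, i.e. of subgraphs
isomorphic to `H`, in a graph `Γ` on the vertex set `Fin n`. -/
noncomputable def count {W : Type u} (H : SimpleGraph W) (n : ℕ) (Γ : SimpleGraph (Fin n)) : ℝ :=
  (Γ.copyCount H : ℝ)

/-- `μ_H = E X_H` in the binomial random graph `G_{n,p}`. -/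
noncomputable def mean {W : Type u} (H : SimpleGraph W) (n : ℕ) (p : I) : ℝ :=
  ∫ Γ, count H n Γ ∂(SimpleGraph.binomialRandom (Fin n) p)

/-- `σ_H = √(Var X_H)` in the binomial random graph `G_{n,p}`. -/
noncomputable def stdDev {W : Type u} (H : SimpleGraph W) (n : ℕ) (p : I) : ℝ :=
  Real.sqrt (variance (count H n) (SimpleGraph.binomialRandom (Fin n) p))

/-- The probability `P(X_H ≥ x)` in the binomial random graph `G_{n,p}`. -/
noncomputable def tailProb {W : Type u} (H : SimpleGraph W) (n : ℕ) (p : I) (x : ℝ) : ℝ :=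
  (SimpleGraph.binomialRandom (Fin n) p).real {Γ | x ≤ count H n Γ}

section Parameters

variable {V : Type u} [Fintype V]

/-- The density `e_F / v_F` of a subgraph `F` of `H`. -/
noncomputable def density {H : SimpleGraph V} (F : H.Subgraph) : ℝ :=
  (F.edgeSet.ncard : ℝ) / (F.verts.ncard : ℝ)

/-- `m_H`, the maximum of `e_F / v_F` over the subgraphs `F ⊆ H` with `v_F ≥ 1`
(a supremum over a finite set). -/
noncomputable def maxDensity (H : SimpleGraph V) : ℝ :=
  ⨆ F : {F : H.Subgraph // F.verts.Nonempty}, density F.1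

/-- `F ⊆ H` is primal for `H` if `e_F / v_F = m_H`. -/
def IsPrimal {H : SimpleGraph V} (F : H.Subgraph) : Prop :=
  F.verts.Nonempty ∧ density F = maxDensity H

/-- `J` covers `G`: `G ⊊ J`, and no primal `F` satisfies `G ⊊ F ⊊ J`. -/
def Covers {H : SimpleGraph V} (J G : H.Subgraph) : Prop :=
  G < J ∧ ∀ F : H.Subgraph, IsPrimal F → ¬ (G < F ∧ F < J)

/-- `Φ_H = min {μ_F : F ⊆ H, e_F ≥ 1}` (an infimum over a finite set). -/
noncomputable def Phi (H : SimpleGraph V) (n : ℕ) (p : I) : ℝ :=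
  ⨅ F : {F : H.Subgraph // F.edgeSet.Nonempty}, mean F.1.coe n p

/-- The fractional independence number `α*`: the maximum of `∑ f v` over all
`f : W → [0,1]` with `f u + f v ≤ 1` for every edge `uv`. -/
noncomputable def fracIndepNum {W : Type u} [Fintype W] (F : SimpleGraph W) : ℝ :=
  sSup {s : ℝ | ∃ f : W → ℝ, (∀ v, 0 ≤ f v ∧ f v ≤ 1) ∧
    (∀ u v, F.Adj u v → f u + f v ≤ 1) ∧ s = ∑ v, f v}

open scoped Classical in
/-- `M_H`: the minimum of `μ_F ^ (1/α*_F)` over all `F ⊆ H` with `e_F ≥ 1` if `p < n^(-1/Δ_H)`,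
and `n² p^Δ_H` otherwise, with `Δ_H` the maximum degree. -/
noncomputable def M (H : SimpleGraph V) (n : ℕ) (p : I) : ℝ :=
  if (p : ℝ) < (n : ℝ) ^ (-(1 / (H.maxDegree : ℝ))) then
    ⨅ F : {F : H.Subgraph // F.edgeSet.Nonempty},
      (mean F.1.coe n p) ^ (1 / fracIndepNum F.1.coe)
  else (n : ℝ) ^ 2 * (p : ℝ) ^ H.maxDegree

/-- `n p^{m_H}` -/
noncomputable def omega (H : SimpleGraph V) (n : ℕ) (p : I) : ℝ :=
  (n : ℝ) * (p : ℝ) ^ maxDensity H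

end Parameters

end UpperTail

namespace UpperTail

universe u

open scoped Classical

/-! ### The binomial random graph as a finite weighted sum -/

section Probability

variable {n : ℕ}

/-! The upper tail is fed by a cheap planted graph. Write m = `maxDensity H`, ω = n p^m, κ = v_K /
r, and let s be an integer with κ < s ≤ v_F for every primal F. Fix one copy of the root G and
attach x copies of each petal J_i ∖ G. Maximality of the density makes distinct petals disjoint and
leaves no edges between them (`inter_of_covers`, `not_adj_of_covers`), so choosing one of the x
copies of each petal independently yields x^r copies of K. Since K again has density m, the expected
number of copies of K is of order ω^(v_K). Hence x ≈ ω^(κ+ε) already produces a constant-factor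
surplus, each copy of K extending to about n^(v_H-v_K) p^(e_H-e_K) copies of H.

The planted graph has O(x) vertices and no subgraph denser than m (`card_blowup_filter_le`), so it
should appear with probability at least exp(-O(x log x)). This is proved together with the abundance
of extensions, by one second moment computation over pairs (placed blow-up, extension). Outside the
tail event every blow-up that is present has at most half of the average number of extensions, so at
least half of the first moment sits on the tail event, and Cauchy–Schwarz bounds its probability
from below without any conditioning (`planting_bound`, `tailProb_lower`). The outcome is -log P ≤
ω^(κ+3ε), a power of ω below ω^s.

On the other side, while ω is below a small power of n, every nonempty vertex set B of H satisfies
n^|B| p^(e(B)) ≥ ω^s (`exists_pow_le_expectation`): sets of maximum density give exactly ω^|B|, all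
others gain a power of 1/p. This bounds Φ_H below by a multiple of ω^s and σ² above by a multiple of
μ²/ω^s. For (a), also M_H ≥ 1, while log(1/p) has order log n, which exceeds ω^s for a suitable `c`.
For (b), λ² is a power of ω strictly between the tail cost and ω^s. -/

instance : MeasurableSingletonClass (SimpleGraph (Fin n)) where
  measurableSet_singleton Γ := by
    have h : ({Γ} : Set (SimpleGraph (Fin n))) = SimpleGraph.edgeSet ⁻¹' {Γ.edgeSet} := by
      ext Δ; simp
    rw [h]
    exact SimpleGraph.measurable_edgeSet (measurableSet_singleton _)

/-- The probability that a given set of `k` pairs is contained in the random graph is `p ^ k`. -/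
theorem binomialRandom_superset (p : I) (S : Finset (Sym2 (Fin n))) (hS : ∀ e ∈ S, ¬ e.IsDiag) :
    (SimpleGraph.binomialRandom (Fin n) p).real {Γ | ∀ e ∈ S, e ∈ Γ.edgeSet} = (p : ℝ) ^ S.card := by
  have h1 : SimpleGraph.binomialRandom (Fin n) p {Γ | ∀ e ∈ S, e ∈ Γ.edgeSet}
      = setBernoulli (Sym2.diagSetᶜ) p {s : Set (Sym2 (Fin n)) | ∀ e ∈ S, e ∈ s} := by
    -- The Bernoulli set almost surely avoids the diagonal, and the sets avoiding it are exactly the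
    -- edge sets of graphs.
    rw [SimpleGraph.binomialRandom_apply', setBernoulli_apply_eq_apply_subsets _ _
      {s : Set (Sym2 (Fin n)) | ∀ e ∈ S, e ∈ s}]
    congr 1
    ext s
    simp only [Set.mem_image, Set.mem_ofPred_eq]
    constructor
    · rintro ⟨Γ, h, rfl⟩
      exact ⟨h, by simp⟩
    · rintro ⟨h, h'⟩
      refine ⟨SimpleGraph.fromEdgeSet s, ?_, ?_⟩
      · intro e he
        rw [SimpleGraph.edgeSet_fromEdgeSet]
        exact ⟨h e he, hS e he⟩
      · rw [SimpleGraph.edgeSet_fromEdgeSet]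
        ext e
        simp only [Set.mem_sdiff]
        exact ⟨fun h => h.1, fun h => ⟨h, h' h⟩⟩
  rw [measureReal_def, h1, setBernoulli_apply']
  have h2 : ((fun p : Sym2 (Fin n) → Prop ↦ {i | p i}) ⁻¹'
      {s : Set (Sym2 (Fin n)) | ∀ e ∈ S, e ∈ s})
      = Set.pi (S : Set (Sym2 (Fin n))) (fun _ => {True}) := by
    ext f
    simp [Set.mem_pi]
  rw [h2, Measure.infinitePi_pi _ (fun _ _ => MeasurableSet.of_discrete)]
  have h3 : ∀ e ∈ S, (unitInterval.toNNReal p • Measure.dirac (e ∈ Sym2.diagSetᶜ)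
      + unitInterval.toNNReal (unitInterval.symm p) • Measure.dirac False) {True}
      = (unitInterval.toNNReal p : ENNReal) := by
    intro e he
    have : (e ∈ (Sym2.diagSetᶜ : Set (Sym2 (Fin n)))) = True := by
      simpa using hS e he
    rw [this]
    simp
  rw [Finset.prod_congr rfl h3]
  simp

theorem integral_eq_weighted_sum (p : I) (f : SimpleGraph (Fin n) → ℝ) :
    ∫ Γ, f Γ ∂(SimpleGraph.binomialRandom (Fin n) p)
      = ∑ Γ, (SimpleGraph.binomialRandom (Fin n) p).real {Γ} * f Γ := by
  rw [integral_fintype (Integrable.of_finite)]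
  simp

theorem measureReal_eq_weighted_sum (p : I) (A : Set (SimpleGraph (Fin n))) :
    (SimpleGraph.binomialRandom (Fin n) p).real A
      = ∑ Γ, (SimpleGraph.binomialRandom (Fin n) p).real {Γ} * (if Γ ∈ A then 1 else 0) := by
  have := integral_eq_weighted_sum p (A.indicator (1 : SimpleGraph (Fin n) → ℝ))
  rw [integral_indicator_one (Set.toFinite A).measurableSet] at this
  rw [this]
  rfl

end Probability

/-! ### Counting copies in the complete graph -/

section Copies

variable {W : Type u} [Fintype W] {n : ℕ}

/-- The vertex set and the edge set of the image of `H` under an injection of its vertices. -/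
noncomputable def copyKey (H : SimpleGraph W) (φ : W ↪ Fin n) :
    Finset (Fin n) × Finset (Sym2 (Fin n)) :=
  (Finset.univ.map φ, H.edgeFinset.map φ.sym2Map)

/-- The copies of `H` in the complete graph on `Fin n`. -/
noncomputable def copyKeys (H : SimpleGraph W) (n : ℕ) :
    Finset (Finset (Fin n) × Finset (Sym2 (Fin n))) :=
  Finset.univ.image (copyKey (n := n) H)

/-- A subgraph is determined by its vertex set and its edge set. The vertex set has to be recorded
because H may have isolated vertices. -/
theorem copyCount_eq_card_copyKeys (H : SimpleGraph W) (Γ : SimpleGraph (Fin n)) :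
    Γ.copyCount H = ((copyKeys H n).filter (fun k => ∀ e ∈ k.2, e ∈ Γ.edgeSet)).card := by
  rw [SimpleGraph.copyCount_eq_card_image_copyToSubgraph]
  have hinj : Function.Injective (fun F : Γ.Subgraph => (F.verts.toFinset, F.edgeSet.toFinset)) := by
    intro F F' h
    simp only [Prod.mk.injEq, Set.toFinset_inj] at h
    ext u v
    · rw [h.1]
    · rw [← SimpleGraph.Subgraph.mem_edgeSet, h.2, SimpleGraph.Subgraph.mem_edgeSet]
  rw [← Finset.card_image_of_injective _ hinj, Finset.image_image]
  congr 1
  have key : ∀ f : H.Copy Γ, (f.toSubgraph.verts.toFinset, f.toSubgraph.edgeSet.toFinset)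
      = copyKey H f.toEmbedding := by
    intro f
    simp only [copyKey, Prod.mk.injEq]
    constructor
    · ext x; simp [SimpleGraph.Copy.toEmbedding]
    · ext e
      simp [SimpleGraph.Copy.toEmbedding, SimpleGraph.Subgraph.edgeSet_map]
  ext k
  simp only [Finset.mem_image, Finset.mem_univ, true_and, Function.comp, Finset.mem_filter, copyKeys]
  constructor
  · rintro ⟨f, rfl⟩
    refine ⟨⟨f.toEmbedding, (key f).symm⟩, ?_⟩
    intro e he
    simp only [Set.mem_toFinset] at he
    exact f.toSubgraph.edgeSet_subset he
  · rintro ⟨⟨φ, rfl⟩, h⟩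
    refine ⟨⟨⟨φ, ?_⟩, φ.injective⟩, ?_⟩
    · intro a b hab
      apply h s(φ a, φ b)
      simp only [copyKey, Finset.mem_map]
      exact ⟨s(a, b), by simpa using hab, rfl⟩
    · rw [key]; rfl

theorem count_eq_sum (H : SimpleGraph W) (n : ℕ) (Γ : SimpleGraph (Fin n)) :
    count H n Γ = ∑ k ∈ copyKeys H n, if (∀ e ∈ k.2, e ∈ Γ.edgeSet) then (1 : ℝ) else 0 := by
  rw [count, copyCount_eq_card_copyKeys]
  simp

theorem copyKey_snd_not_isDiag (H : SimpleGraph W) (φ : W ↪ Fin n) :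
    ∀ e ∈ (copyKey H φ).2, ¬ e.IsDiag := by
  intro e he
  simp only [copyKey, Finset.mem_map] at he
  obtain ⟨e', he', rfl⟩ := he
  have := H.not_isDiag_of_mem_edgeSet (SimpleGraph.mem_edgeFinset.1 he')
  rwa [Function.Embedding.sym2Map_apply, Sym2.isDiag_map φ.injective]

theorem copyKey_snd_card (H : SimpleGraph W) (φ : W ↪ Fin n) :
    (copyKey H φ).2.card = H.edgeFinset.card := by
  simp [copyKey]

theorem mean_eq (H : SimpleGraph W) (n : ℕ) (p : I) :
    mean H n p = (copyKeys H n).card * (p : ℝ) ^ H.edgeFinset.card := by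
  rw [mean, integral_eq_weighted_sum]
  simp_rw [count_eq_sum, Finset.mul_sum]
  rw [Finset.sum_comm, ← nsmul_eq_mul, ← Finset.sum_const]
  refine Finset.sum_congr rfl fun k hk => ?_
  obtain ⟨φ, -, rfl⟩ := Finset.mem_image.1 hk
  rw [← copyKey_snd_card H φ, ← binomialRandom_superset p _ (copyKey_snd_not_isDiag H φ),
    measureReal_eq_weighted_sum]
  simp only [Set.mem_ofPred_eq]
  congr!

theorem card_copyKeys_le (H : SimpleGraph W) (n : ℕ) :
    (copyKeys H n).card ≤ n ^ Fintype.card W := by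
  refine Finset.card_image_le.trans ?_
  calc Fintype.card (W ↪ Fin n) ≤ Fintype.card (W → Fin n) :=
        Fintype.card_le_of_injective _ DFunLike.coe_injective
    _ = _ := by simp

/-- Reserve a separate block of N points for each vertex of H. The vertex set of a copy with one
vertex in each block already reveals the point chosen in each block. -/
theorem pow_le_card_copyKeys (H : SimpleGraph W) {n N : ℕ} (h : Fintype.card W * N ≤ n) :
    N ^ Fintype.card W ≤ (copyKeys H n).card := by
  obtain ⟨ι⟩ : Nonempty (W × Fin N ↪ Fin n) :=
    Function.Embedding.nonempty_of_card_le (by simpa using h)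
  let Ψ : (W → Fin N) → (W ↪ Fin n) := fun f =>
    ⟨fun w => ι (w, f w), fun a b hab => congrArg Prod.fst (ι.injective hab)⟩
  have hΨ : Function.Injective (fun f => copyKey H (Ψ f)) := by
    intro f g hfg
    funext w
    have h1 : Ψ f w ∈ Finset.univ.map (Ψ g) := by
      have : (copyKey H (Ψ f)).1 = (copyKey H (Ψ g)).1 := congrArg Prod.fst hfg
      simp only [copyKey] at this
      rw [← this]; simp
    obtain ⟨w', -, hw'⟩ := Finset.mem_map.1 h1
    have := ι.injective hw'
    simp only [Prod.mk.injEq] at this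
    obtain ⟨rfl, h2⟩ := this
    exact h2.symm
  calc N ^ Fintype.card W = (Finset.univ : Finset (W → Fin N)).card := by simp
    _ = (Finset.univ.image (fun f => copyKey H (Ψ f))).card :=
        (Finset.card_image_of_injective _ hΨ).symm
    _ ≤ _ := Finset.card_le_card (by
        intro k hk
        obtain ⟨f, -, rfl⟩ := Finset.mem_image.1 hk
        exact Finset.mem_image_of_mem _ (Finset.mem_univ _))

end Copies

/-! ### The second moment method restricted to an event -/

section SecondMoment

/-- A second moment lower bound for finite weighted sums. -/
theorem weighted_second_moment {Ω : Type*} [Fintype Ω] (w T : Ω → ℝ) (hw : ∀ x, 0 ≤ w x)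
    (A : Set Ω) (m : ℝ) (hm : 0 ≤ m) (hT : ∑ x, w x * T x = m)
    (hA : ∑ x, w x * (if x ∈ A then 0 else T x) ≤ m / 2) :
    m ^ 2 ≤ 4 * (∑ x, w x * (if x ∈ A then 1 else 0)) * ∑ x, w x * T x ^ 2 := by
  have h1 : m / 2 ≤ ∑ x, w x * (if x ∈ A then T x else 0) := by
    have : ∑ x, w x * (if x ∈ A then T x else 0) + ∑ x, w x * (if x ∈ A then 0 else T x) = m := by
      rw [← Finset.sum_add_distrib, ← hT]
      refine Finset.sum_congr rfl fun x _ => ?_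
      split_ifs <;> ring
    linarith
  have h2 : (∑ x, w x * (if x ∈ A then T x else 0)) ^ 2
      ≤ (∑ x, w x * (if x ∈ A then 1 else 0)) * ∑ x, w x * T x ^ 2 := by
    -- Cauchy–Schwarz, with each weight split as a product of two square roots.
    have := Finset.sum_mul_sq_le_sq_mul_sq Finset.univ
      (fun x => √(w x) * (if x ∈ A then 1 else 0)) (fun x => √(w x) * T x)
    have e1 : ∑ x, (√(w x) * (if x ∈ A then (1 : ℝ) else 0)) * (√(w x) * T x)
        = ∑ x, w x * (if x ∈ A then T x else 0) := by
      refine Finset.sum_congr rfl fun x _ => ?_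
      have := Real.mul_self_sqrt (hw x)
      split_ifs
      · linear_combination (T x) * this
      · ring
    have e2 : ∑ x, (√(w x) * (if x ∈ A then (1 : ℝ) else 0)) ^ 2
        = ∑ x, w x * (if x ∈ A then 1 else 0) := by
      refine Finset.sum_congr rfl fun x _ => ?_
      rw [mul_pow, Real.sq_sqrt (hw x)]
      split_ifs <;> ring
    have e3 : ∑ x, (√(w x) * T x) ^ 2 = ∑ x, w x * T x ^ 2 := by
      refine Finset.sum_congr rfl fun x _ => ?_
      rw [mul_pow, Real.sq_sqrt (hw x)]
    rwa [e1, e2, e3] at this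
  nlinarith [pow_le_pow_left₀ (by positivity : 0 ≤ m / 2) h1 2]

variable {n : ℕ}

theorem integral_indicator_superset (p : I) (S : Finset (Sym2 (Fin n)))
    (hS : ∀ e ∈ S, ¬ e.IsDiag) :
    ∑ Γ, (SimpleGraph.binomialRandom (Fin n) p).real {Γ} *
      (if ∀ e ∈ S, e ∈ Γ.edgeSet then (1 : ℝ) else 0) = (p : ℝ) ^ S.card := by
  rw [← binomialRandom_superset p S hS, measureReal_eq_weighted_sum]
  simp only [Set.mem_ofPred_eq]
  congr!

/-- A second moment lower bound for the probability of an event on which most of the expectation of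
the number of present sets from a family is concentrated. -/
theorem second_moment_family {τ : Type*} [Fintype τ] (p : I) (hp : 0 < (p : ℝ))
    (E : τ → Finset (Sym2 (Fin n))) (hE : ∀ t, ∀ e ∈ E t, ¬ e.IsDiag) (L : ℕ)
    (hL : ∀ t, (E t).card = L) (A : Set (SimpleGraph (Fin n)))
    (hA : ∑ Γ, (SimpleGraph.binomialRandom (Fin n) p).real {Γ} * (if Γ ∈ A then 0 else
        ∑ t, if ∀ e ∈ E t, e ∈ Γ.edgeSet then (1 : ℝ) else 0)
        ≤ (Fintype.card τ * (p : ℝ) ^ L) / 2) :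
    (Fintype.card τ : ℝ) ^ 2 ≤ 4 * (SimpleGraph.binomialRandom (Fin n) p).real A *
      ∑ t, ∑ t', ((p : ℝ) ^ (E t ∩ E t').card)⁻¹ := by
  have h := weighted_second_moment
    (fun Γ => (SimpleGraph.binomialRandom (Fin n) p).real {Γ})
    (fun Γ => ∑ t, if ∀ e ∈ E t, e ∈ Γ.edgeSet then (1 : ℝ) else 0)
    (fun _ => measureReal_nonneg) A (Fintype.card τ * (p : ℝ) ^ L) (by positivity) ?_ hA
  · rw [← measureReal_eq_weighted_sum] at h
    have h2 : ∑ Γ, (SimpleGraph.binomialRandom (Fin n) p).real {Γ} *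
        (∑ t, if ∀ e ∈ E t, e ∈ Γ.edgeSet then (1 : ℝ) else 0) ^ 2
        = (p : ℝ) ^ (2 * L) * ∑ t, ∑ t', ((p : ℝ) ^ (E t ∩ E t').card)⁻¹ := by
      simp_rw [sq, Finset.sum_mul_sum, Finset.mul_sum]
      rw [Finset.sum_comm]
      refine Finset.sum_congr rfl fun t _ => ?_
      rw [Finset.sum_comm]
      refine Finset.sum_congr rfl fun t' _ => ?_
      -- Both sets are present with probability p^|E ∪ E'| = p^(2L) · p^(-|E ∩ E'|).
      have e1 : (E t ∪ E t').card + (E t ∩ E t').card = 2 * L := by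
        rw [Finset.card_union_add_card_inter, hL, hL, two_mul]
      rw [← e1, pow_add, mul_assoc, mul_inv_cancel₀ (by positivity), mul_one,
        ← integral_indicator_superset]
      · refine Finset.sum_congr rfl fun Γ _ => ?_
        congr 1
        simp only [Finset.mem_union, or_imp, forall_and]
        by_cases h1 : ∀ e ∈ E t, e ∈ Γ.edgeSet
        · by_cases h2 : ∀ e ∈ E t', e ∈ Γ.edgeSet
          · rw [if_pos h1, if_pos h2, if_pos ⟨h1, h2⟩, mul_one]
          · rw [if_neg h2, if_neg (fun h : _ ∧ _ => h2 h.2), mul_zero]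
        · rw [if_neg h1, if_neg (fun h : _ ∧ _ => h1 h.1), zero_mul]
      · intro e he
        rcases Finset.mem_union.1 he with he | he
        exacts [hE _ _ he, hE _ _ he]
    rw [h2, mul_pow, ← pow_mul, mul_comm L 2] at h
    have hpos : 0 < (p : ℝ) ^ (2 * L) := by positivity
    refine le_of_mul_le_mul_right ?_ hpos
    calc _ ≤ _ := h
      _ = _ := by ring
  · simp_rw [Finset.mul_sum]
    rw [Finset.sum_comm, ← nsmul_eq_mul, ← Finset.card_univ, ← Finset.sum_const]
    refine Finset.sum_congr rfl fun t _ => ?_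
    rw [integral_indicator_superset p _ (hE t), hL]

end SecondMoment

/-! ### Generating function of agreements between two functions -/

section Agreement

variable {ι α : Type*} [Fintype ι] [Fintype α]

/-- The places where two functions agree. -/
noncomputable def agree (f g : ι → α) : Finset ι := Finset.univ.filter fun i => f i = g i

/-- For fixed `f` the sum over `g` factors over the coordinates: one value contributes `q`, each of
the others 1. -/
theorem sum_agree_le [DecidableEq ι] (q : ℝ) (hq : 0 ≤ q) [Nonempty α] :
    ∑ f : ι → α, ∑ g : ι → α, q ^ (agree f g).card
      ≤ ((Fintype.card α : ℝ) ^ Fintype.card ι) ^ 2 *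
        (1 + q / Fintype.card α) ^ Fintype.card ι := by
  have hpos : (0 : ℝ) < Fintype.card α := by exact_mod_cast Fintype.card_pos
  have h1 : ∀ f : ι → α, ∑ g : ι → α, q ^ (agree f g).card
      ≤ (Fintype.card α + q : ℝ) ^ Fintype.card ι := by
    intro f
    have : ∀ g : ι → α, q ^ (agree f g).card = ∏ i, if f i = g i then q else 1 := by
      intro g
      simp [agree, Finset.prod_ite]
    simp_rw [this]
    have e := Finset.prod_univ_sum (fun _ : ι => (Finset.univ : Finset α))
      (fun i a => if f i = a then q else 1)
    rw [Fintype.piFinset_univ] at e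
    rw [← e]
    calc _ ≤ ∏ i : ι, (Fintype.card α + q : ℝ) := by
          refine Finset.prod_le_prod (fun i _ => Finset.sum_nonneg fun a _ => by
            split_ifs <;> simp [hq]) fun i _ => ?_
          calc ∑ a, (if f i = a then q else 1) ≤ ∑ a, (1 + if f i = a then q else 0) := by
                refine Finset.sum_le_sum fun a _ => ?_
                split_ifs <;> simp
            _ = _ := by simp [Finset.sum_add_distrib]
      _ = _ := by simp
  calc _ ≤ ∑ f : ι → α, (Fintype.card α + q : ℝ) ^ Fintype.card ι :=
        Finset.sum_le_sum fun f _ => h1 f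
    _ = (Fintype.card α : ℝ) ^ Fintype.card ι * (Fintype.card α + q) ^ Fintype.card ι := by simp
    _ = (Fintype.card α : ℝ) ^ Fintype.card ι *
        (Fintype.card α * (1 + q / Fintype.card α)) ^ Fintype.card ι := by
        congr 2; field_simp
    _ = _ := by rw [mul_pow]; ring

end Agreement

/-! ### Intersections of images of edge sets -/

section Sym2

variable {A B : Type*}

/-- The hypothesis says that different points have disjoint ranges of possible images. An image edge
therefore remembers its preimage, and a swap of the two ends is harmless. -/
theorem sym2_map_eq_map {f g : A → B} (h : ∀ x y, f x = g y → x = y) {d d' : Sym2 A}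
    (hd : Sym2.map f d = Sym2.map g d') : d = d' ∧ ∀ x ∈ d, f x = g x := by
  induction d using Sym2.ind with | _ a b =>
  induction d' using Sym2.ind with | _ a' b' =>
  simp only [Sym2.map_mk, Sym2.eq_iff] at hd
  rcases hd with ⟨h1, h2⟩ | ⟨h1, h2⟩
  · obtain rfl := h _ _ h1
    obtain rfl := h _ _ h2
    exact ⟨rfl, by simp [h1, h2]⟩
  · obtain rfl := h _ _ h1
    obtain rfl := h _ _ h2
    exact ⟨Sym2.eq_swap, by simp [h1, h2]⟩

theorem card_image_map_inter_le [DecidableEq (Sym2 B)] {S T : Finset (Sym2 A)} {f g : A → B}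
    (h : ∀ x y, f x = g y → x = y) (hT : ∀ e ∈ S, (∀ x ∈ e, f x = g x) → e ∈ T) :
    (S.image (Sym2.map f) ∩ S.image (Sym2.map g)).card ≤ T.card := by
  refine (Finset.card_le_card (t := T.image (Sym2.map f)) ?_).trans Finset.card_image_le
  intro e he
  simp only [Finset.mem_inter, Finset.mem_image] at he
  obtain ⟨⟨d, hd, rfl⟩, d', hd', h2⟩ := he
  obtain ⟨rfl, h3⟩ := sym2_map_eq_map h h2.symm
  exact Finset.mem_image_of_mem _ (hT d hd h3)

theorem card_union_inter_union_le [DecidableEq A] {S T S' T' : Finset A} (h : Disjoint S T')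
    (h' : Disjoint S' T) :
    ((S ∪ T) ∩ (S' ∪ T')).card ≤ (S ∩ S').card + (T ∩ T').card := by
  refine (Finset.card_le_card fun e he => ?_).trans (Finset.card_union_le _ _)
  rw [Finset.disjoint_left] at h h'
  have d1 := @h e
  have d2 := @h' e
  simp only [Finset.mem_inter, Finset.mem_union] at he ⊢
  tauto

end Sym2

/-! ### Edges added to a set of maximum density -/

section Density

variable {V : Type u} [Fintype V]

/-- The edges of `H` with both ends in `B`. -/
noncomputable def edgesIn (H : SimpleGraph V) (B : Finset V) : Finset (Sym2 V) :=
  H.edgeFinset.filter fun e => ∀ u ∈ e, u ∈ B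

/-- The edges of `H` with both ends in `P ∪ B` and at least one end in `B`. -/
noncomputable def edgesAdding (H : SimpleGraph V) (P B : Finset V) : Finset (Sym2 V) :=
  H.edgeFinset.filter fun e => (∀ u ∈ e, u ∈ P ∪ B) ∧ ∃ u ∈ e, u ∈ B

theorem card_edgesIn_union {H : SimpleGraph V} {P B : Finset V} (hd : Disjoint P B) :
    (edgesIn H (P ∪ B)).card = (edgesIn H P).card + (edgesAdding H P B).card := by
  rw [← Finset.card_union_of_disjoint]
  · congr 1
    ext e
    simp only [edgesIn, edgesAdding, Finset.mem_filter, Finset.mem_union]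
    constructor
    · rintro ⟨h1, h2⟩
      by_cases h3 : ∃ u ∈ e, u ∈ B
      · exact Or.inr ⟨h1, h2, h3⟩
      · push Not at h3
        exact Or.inl ⟨h1, fun u hu => (h2 u hu).resolve_right (h3 u hu)⟩
    · rintro (⟨h1, h2⟩ | ⟨h1, h2, -⟩)
      · exact ⟨h1, fun u hu => Or.inl (h2 u hu)⟩
      · exact ⟨h1, h2⟩
  · rw [Finset.disjoint_left]
    intro e h1 h2
    simp only [edgesIn, edgesAdding, Finset.mem_filter] at h1 h2
    obtain ⟨u, hu, hB⟩ := h2.2.2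
    exact Finset.disjoint_left.1 hd (h1.2 u hu) hB

/-- Subtract the equality for `P` from the density bound for `P ∪ B`: on top of a set of full
density, each new vertex brings at most `m` edges on average. -/
theorem card_edgesAdding_le {H : SimpleGraph V} {m : ℝ} {P B : Finset V}
    (hden : ∀ B : Finset V, ((edgesIn H B).card : ℝ) ≤ m * B.card)
    (hP : ((edgesIn H P).card : ℝ) = m * P.card) (hd : Disjoint P B) :
    ((edgesAdding H P B).card : ℝ) ≤ m * B.card := by
  have h1 := hden (P ∪ B)
  rw [card_edgesIn_union hd, Finset.card_union_of_disjoint hd] at h1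
  push_cast at h1
  linarith

end Density

/-! ### The blow-up of the petals over a common root -/

section Blowup

variable {V : Type u} {X α : Type} {r : ℕ}

/-- The label of the vertex `u` in the `j`-th extension of the root `G`. -/
noncomputable def label (G : Finset V) (j₀ j : X) (u : V) : X := if u ∈ G then j₀ else j

/-- The position of a vertex of the blow-up. -/
def place (s : V × X → α) (x : V × X) : V × X × α := (x.1, x.2, s x)

theorem place_inj {s s' : V × X → α} (x y : V × X) (h : place s x = place s' y) : x = y := by
  simp only [place, Prod.mk.injEq] at h
  exact Prod.ext h.1 h.2.1

/-- The vertex map of the copy of `H` given by the positions `s` of the blow-up, a choice `j` of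
labels and the positions `ρ` of the remaining vertices. -/
noncomputable def embed (G K : Finset V) (j₀ : X) (l : V → Fin r) (s : V × X → α) (j : Fin r → X)
    (ρ : {u // u ∉ K} → X × α) (u : V) : V × X × α :=
  if h : u ∈ K then place s (u, label G j₀ (j (l u)) u) else (u, ρ ⟨u, h⟩)

theorem embed_fst (G K : Finset V) (j₀ : X) (l : V → Fin r) (s : V × X → α) (j : Fin r → X)
    (ρ : {u // u ∉ K} → X × α) (u : V) : (embed G K j₀ l s j ρ u).1 = u := by
  unfold embed place; split_ifs <;> rfl

/-- Every vertex of H has its own class of positions, recorded in the first coordinate. This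
excludes collisions within one map and also between maps built from different data. -/
theorem embed_inj {G K : Finset V} {j₀ : X} {l : V → Fin r} {s s' : V × X → α} {j j' : Fin r → X}
    {ρ ρ' : {u // u ∉ K} → X × α} (x y : V)
    (h : embed G K j₀ l s j ρ x = embed G K j₀ l s' j' ρ' y) : x = y := by
  rw [← embed_fst G K j₀ l s j ρ x, h, embed_fst]

variable [Fintype V]

/-- The edges of `H` not contained in `K`. -/
noncomputable def edgesOut (H : SimpleGraph V) (K : Finset V) : Finset (Sym2 V) :=
  H.edgeFinset.filter fun e => ¬ ∀ u ∈ e, u ∈ K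

theorem card_edgesIn_add_card_edgesOut (H : SimpleGraph V) (K : Finset V) :
    (edgesIn H K).card + (edgesOut H K).card = H.edgeFinset.card :=
  Finset.card_filter_add_card_filter_not _

/-- The edges of a copy of `H` that lie outside of the blow-up. -/
noncomputable def outerEdges (H : SimpleGraph V) (G K : Finset V) (j₀ : X) (l : V → Fin r)
    (s : V × X → α) (j : Fin r → X) (ρ : {u // u ∉ K} → X × α) : Finset (Sym2 (V × X × α)) :=
  (edgesOut H K).image (Sym2.map (embed G K j₀ l s j ρ))

theorem card_outerEdges (H : SimpleGraph V) (G K : Finset V) (j₀ : X) (l : V → Fin r)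
    (s : V × X → α) (j : Fin r → X) (ρ : {u // u ∉ K} → X × α) :
    (outerEdges H G K j₀ l s j ρ).card = (edgesOut H K).card :=
  Finset.card_image_of_injective _ (Sym2.map.injective fun x y h => embed_inj x y h)

theorem outerEdges_not_isDiag {H : SimpleGraph V} {G K : Finset V} {j₀ : X} {l : V → Fin r}
    {s : V × X → α} {j : Fin r → X} {ρ : {u // u ∉ K} → X × α} :
    ∀ e ∈ outerEdges H G K j₀ l s j ρ, ¬ e.IsDiag := by
  intro e he
  simp only [outerEdges, Finset.mem_image, edgesOut, Finset.mem_filter] at he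
  obtain ⟨b, hb, rfl⟩ := he
  rw [Sym2.isDiag_map (fun x y h => embed_inj x y h)]
  exact H.not_isDiag_of_mem_edgeSet (SimpleGraph.mem_edgeFinset.1 hb.1)

variable [Fintype X]

/-- The edges of the graph obtained from `H[K]` by taking one copy, for each label, of the part
outside of the root `G`. -/
noncomputable def blowup (H : SimpleGraph V) (G K : Finset V) (j₀ : X) : Finset (Sym2 (V × X)) :=
  Finset.univ.biUnion fun j : X => (edgesIn H K).image (Sym2.map fun u => (u, label G j₀ j u))

/-- The edges of the blow-up placed by `s`. -/
noncomputable def blowupEdges (H : SimpleGraph V) (G K : Finset V) (j₀ : X) (s : V × X → α) :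
    Finset (Sym2 (V × X × α)) :=
  (blowup H G K j₀).image (Sym2.map (place s))

theorem fst_mem_of_mem_blowupEdges {H : SimpleGraph V} {G K : Finset V} {j₀ : X} {s : V × X → α}
    {e : Sym2 (V × X × α)} (he : e ∈ blowupEdges H G K j₀ s) : ∀ x ∈ e, x.1 ∈ K := by
  simp only [blowupEdges, blowup, Finset.mem_image, Finset.mem_biUnion, Finset.mem_univ, true_and,
    edgesIn, Finset.mem_filter] at he
  obtain ⟨d, ⟨j, b, hb, rfl⟩, rfl⟩ := he
  intro x hx
  simp only [Sym2.map_map, Sym2.mem_map] at hx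
  obtain ⟨u, hu, rfl⟩ := hx
  exact hb.2 u hu

theorem disjoint_blowupEdges_outerEdges (H : SimpleGraph V) (G K : Finset V) (j₀ : X)
    (l : V → Fin r) (s s' : V × X → α) (j : Fin r → X) (ρ : {u // u ∉ K} → X × α) :
    Disjoint (blowupEdges H G K j₀ s) (outerEdges H G K j₀ l s' j ρ) := by
  rw [Finset.disjoint_left]
  intro e he he'
  simp only [outerEdges, Finset.mem_image, edgesOut, Finset.mem_filter] at he'
  obtain ⟨d, ⟨-, hd⟩, rfl⟩ := he'
  push Not at hd
  obtain ⟨u, hu, huK⟩ := hd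
  have := fst_mem_of_mem_blowupEdges he (embed G K j₀ l s' j ρ u) (Sym2.mem_map.2 ⟨u, hu, rfl⟩)
  rw [embed_fst] at this
  exact huK this

theorem card_blowupEdges (H : SimpleGraph V) (G K : Finset V) (j₀ : X) (s : V × X → α) :
    (blowupEdges H G K j₀ s).card = (blowup H G K j₀).card :=
  Finset.card_image_of_injective _ (Sym2.map.injective fun x y h => place_inj x y h)

theorem blowupEdges_not_isDiag {H : SimpleGraph V} {G K : Finset V} {j₀ : X} {s : V × X → α} :
    ∀ e ∈ blowupEdges H G K j₀ s, ¬ e.IsDiag := by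
  intro e he
  simp only [blowupEdges, blowup, Finset.mem_image, Finset.mem_biUnion, Finset.mem_univ, true_and,
    edgesIn, Finset.mem_filter] at he
  obtain ⟨d, ⟨j, b, hb, rfl⟩, rfl⟩ := he
  rw [Sym2.isDiag_map (fun x y h => place_inj x y h),
    Sym2.isDiag_map (fun x y h => congrArg Prod.fst h)]
  exact H.not_isDiag_of_mem_edgeSet (SimpleGraph.mem_edgeFinset.1 hb.1)

/-- All edges of the embedded copy of `H` belong to the blow-up or to the outer edges. -/
theorem map_embed_mem {H : SimpleGraph V} {G K : Finset V} {j₀ : X} {l : V → Fin r}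
    (hl : ∀ u v, H.Adj u v → u ∈ K → v ∈ K → u ∉ G → v ∉ G → l u = l v)
    (s : V × X → α) (j : Fin r → X) (ρ : {u // u ∉ K} → X × α) {e : Sym2 V}
    (he : e ∈ H.edgeFinset) :
    Sym2.map (embed G K j₀ l s j ρ) e
      ∈ blowupEdges H G K j₀ s ∪ outerEdges H G K j₀ l s j ρ := by
  rw [Finset.mem_union]
  by_cases hK : ∀ u ∈ e, u ∈ K
  · left
    -- Distinct petals are not joined, and vertices of `G` ignore the label, so an edge inside `K`
    -- sees a single label: that of an end outside `G`, if there is one.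
    have key : ∃ a : X, ∀ u ∈ e, label G j₀ (j (l u)) u = label G j₀ a u := by
      induction e using Sym2.ind with | _ u v =>
      have hadj : H.Adj u v := by simpa using he
      by_cases hv : v ∈ G
      · refine ⟨j (l u), ?_⟩
        simp [label, hv]
      · refine ⟨j (l v), ?_⟩
        by_cases hu : u ∈ G
        · simp [label, hu]
        · simp [hl u v hadj (hK u (by simp)) (hK v (by simp)) hu hv]
    obtain ⟨a, ha⟩ := key
    simp only [blowupEdges, blowup, Finset.mem_image, Finset.mem_biUnion, Finset.mem_univ, true_and]
    refine ⟨_, ⟨a, e, Finset.mem_filter.2 ⟨he, hK⟩, rfl⟩, ?_⟩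
    rw [Sym2.map_map]
    refine Sym2.map_congr fun u hu => ?_
    simp only [Function.comp, embed, dif_pos (hK u hu), ha u hu]
  · right
    exact Finset.mem_image_of_mem _ (Finset.mem_filter.2 ⟨he, hK⟩)

/-- The blow-up is at most as dense as `H`. -/
theorem card_blowup_filter_le {H : SimpleGraph V} {m : ℝ} (hm : 0 ≤ m) {G K : Finset V} (j₀ : X)
    (hden : ∀ B : Finset V, ((edgesIn H B).card : ℝ) ≤ m * B.card)
    (hG : ((edgesIn H G).card : ℝ) = m * G.card) (A : Finset (V × X)) :
    (((blowup H G K j₀).filter fun e => ∀ x ∈ e, x ∈ A).card : ℝ) ≤ m * A.card := by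
  -- Split `A` into its root part `A₀` and one petal part `B j` for each label. Edges meeting `B j`
  -- are counted as if all of `G` were available; since `G` has full density, they still number at
  -- most `m * (B j).card`.
  set A₀ : Finset V := G.filter fun u => (u, j₀) ∈ A with hA₀
  set B : X → Finset V := fun j => (K \ G).filter fun u => (u, j) ∈ A with hB
  have hsub : ((blowup H G K j₀).filter fun e => ∀ x ∈ e, x ∈ A) ⊆
      (edgesIn H A₀).image (Sym2.map fun u => (u, j₀)) ∪
      Finset.univ.biUnion fun j : X =>
        (edgesAdding H G (B j)).image (Sym2.map fun u => (u, label G j₀ j u)) := by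
    intro e he
    simp only [blowup, Finset.mem_filter, Finset.mem_biUnion, Finset.mem_univ, true_and,
      Finset.mem_image] at he
    obtain ⟨⟨j, d, hd, rfl⟩, hA⟩ := he
    have hd' := Finset.mem_filter.1 hd
    have hA' : ∀ u ∈ d, (u, label G j₀ j u) ∈ A := fun u hu =>
      hA _ (Sym2.mem_map.2 ⟨u, hu, rfl⟩)
    rw [Finset.mem_union]
    by_cases hGd : ∀ u ∈ d, u ∈ G
    · left
      refine Finset.mem_image.2 ⟨d, Finset.mem_filter.2 ⟨hd'.1, fun u hu => ?_⟩, ?_⟩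
      · rw [hA₀, Finset.mem_filter]
        exact ⟨hGd u hu, by simpa [label, hGd u hu] using hA' u hu⟩
      · refine Sym2.map_congr fun u hu => ?_
        simp [label, hGd u hu]
    · right
      have hmem : ∀ u ∈ d, u ∉ G → u ∈ B j := fun u hu hG => by
        simp only [hB, Finset.mem_filter, Finset.mem_sdiff]
        exact ⟨⟨hd'.2 u hu, hG⟩, by simpa [label, hG] using hA' u hu⟩
      refine Finset.mem_biUnion.2 ⟨j, Finset.mem_univ _, Finset.mem_image_of_mem _ ?_⟩
      refine Finset.mem_filter.2 ⟨hd'.1, fun u hu => ?_, ?_⟩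
      · rw [Finset.mem_union]
        by_cases hG : u ∈ G
        · exact Or.inl hG
        · exact Or.inr (hmem u hu hG)
      · push Not at hGd
        obtain ⟨u, hu, hG⟩ := hGd
        exact ⟨u, hu, hmem u hu hG⟩
  have hBG : ∀ j, Disjoint G (B j) := fun j => by
    rw [Finset.disjoint_left]
    intro u hu hu'
    exact (Finset.mem_sdiff.1 (Finset.mem_filter.1 hu').1).2 hu
  have hcard : A₀.card + ∑ j, (B j).card ≤ A.card := by
    have h1 : A.card = ∑ j, (Finset.univ.filter fun u => (u, j) ∈ A).card := by
      rw [Finset.card_eq_sum_card_fiberwise (f := Prod.snd) (t := Finset.univ) (by simp)]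
      refine Finset.sum_congr rfl fun j _ => ?_
      rw [← Finset.card_image_of_injective (Finset.univ.filter fun u => (u, j) ∈ A)
        (f := fun u => (u, j)) (fun a b h => congrArg Prod.fst h)]
      congr 1
      ext ⟨u, j'⟩
      simp only [Finset.mem_filter, Finset.mem_image, Finset.mem_univ, true_and, Prod.mk.injEq]
      constructor
      · rintro ⟨h, rfl⟩; exact ⟨u, h, rfl, rfl⟩
      · rintro ⟨u', h, rfl, rfl⟩; exact ⟨h, rfl⟩
    -- The root is charged to the fibre of the label `j₀`, which it shares with one petal part
    -- disjoint from it.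
    have h2 : A₀.card = ∑ j, if j = j₀ then A₀.card else 0 := by simp
    rw [h1, h2, ← Finset.sum_add_distrib]
    refine Finset.sum_le_sum fun j _ => ?_
    split_ifs with hj
    · subst hj
      rw [← Finset.card_union_of_disjoint
        ((hBG j).mono_left (Finset.filter_subset _ _))]
      refine Finset.card_le_card fun u hu => ?_
      rcases Finset.mem_union.1 hu with hu | hu <;> simp [(Finset.mem_filter.1 hu).2]
    · rw [zero_add]
      refine Finset.card_le_card fun u hu => ?_
      simp [(Finset.mem_filter.1 hu).2]
  calc (((blowup H G K j₀).filter fun e => ∀ x ∈ e, x ∈ A).card : ℝ)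
      ≤ ((edgesIn H A₀).card + ∑ j, (edgesAdding H G (B j)).card : ℕ) := by
        refine Nat.cast_le.2 ((Finset.card_le_card hsub).trans
          ((Finset.card_union_le _ _).trans (add_le_add Finset.card_image_le
            (Finset.card_biUnion_le.trans (Finset.sum_le_sum fun j _ => Finset.card_image_le)))))
    _ ≤ m * A₀.card + ∑ j, m * (B j).card := by
        push_cast
        exact add_le_add (hden _) (Finset.sum_le_sum fun j _ => card_edgesAdding_le hden hG (hBG j))
    _ = m * ((A₀.card + ∑ j, (B j).card : ℕ) : ℝ) := by
        push_cast; rw [mul_add, Finset.mul_sum]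
    _ ≤ m * A.card := by
        exact mul_le_mul_of_nonneg_left (Nat.cast_le.2 hcard) hm

/-- This is the exponent in the second moment. Common blow-up edges span only agreeing positions,
where the blow-up has density at most `m`; common outer edges are edges added to the tight set `K`;
an outer edge leaves the classes of `K` and so is never a blow-up edge. The choices `j`, `j'` of
labels do not enter the bound. -/
theorem card_inter_le [Fintype α] {H : SimpleGraph V} {m : ℝ} (hm : 0 ≤ m) {G K : Finset V} (j₀ : X)
    (hden : ∀ B : Finset V, ((edgesIn H B).card : ℝ) ≤ m * B.card)
    (hG : ((edgesIn H G).card : ℝ) = m * G.card) (hK : ((edgesIn H K).card : ℝ) = m * K.card)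
    (l : V → Fin r) (s s' : V × X → α) (j j' : Fin r → X) (ρ ρ' : {u // u ∉ K} → X × α) :
    (((blowupEdges H G K j₀ s ∪ outerEdges H G K j₀ l s j ρ) ∩
      (blowupEdges H G K j₀ s' ∪ outerEdges H G K j₀ l s' j' ρ')).card : ℝ)
      ≤ m * ((agree s s').card + (agree ρ ρ').card : ℕ) := by
  have h1 : ((blowupEdges H G K j₀ s ∩ blowupEdges H G K j₀ s').card : ℝ)
      ≤ m * (agree s s').card := by
    refine le_trans (Nat.cast_le.2 (card_image_map_inter_le place_inj fun e he h => ?_))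
      (card_blowup_filter_le (K := K) hm j₀ hden hG (agree s s'))
    rw [Finset.mem_filter]
    refine ⟨he, fun x hx => ?_⟩
    have := h x hx
    simp only [place, Prod.mk.injEq, true_and] at this
    simp [agree, this]
  have h2 : ((outerEdges H G K j₀ l s j ρ ∩ outerEdges H G K j₀ l s' j' ρ').card : ℝ)
      ≤ m * (agree ρ ρ').card := by
    have hd : Disjoint K ((agree ρ ρ').map (Function.Embedding.subtype _)) := by
      rw [Finset.disjoint_left]
      intro u hu hu'
      obtain ⟨v, -, rfl⟩ := Finset.mem_map.1 hu'
      exact v.2 hu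
    have := card_edgesAdding_le hden hK hd
    rw [Finset.card_map] at this
    refine le_trans (Nat.cast_le.2 (card_image_map_inter_le embed_inj fun e he h => ?_)) this
    simp only [edgesOut, Finset.mem_filter] at he
    have hmem : ∀ u ∈ e, u ∉ K → u ∈ (agree ρ ρ').map (Function.Embedding.subtype _) := by
      intro u hu huK
      have := h u hu
      simp only [embed, dif_neg huK, Prod.mk.injEq, true_and] at this
      exact Finset.mem_map.2 ⟨⟨u, huK⟩, by simp [agree, this], rfl⟩
    refine Finset.mem_filter.2 ⟨he.1, fun u hu => ?_, ?_⟩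
    · rw [Finset.mem_union]
      by_cases huK : u ∈ K
      · exact Or.inl huK
      · exact Or.inr (hmem u hu huK)
    · have := he.2
      push Not at this
      obtain ⟨u, hu, huK⟩ := this
      exact ⟨u, hu, hmem u hu huK⟩
  have h3 := card_union_inter_union_le (disjoint_blowupEdges_outerEdges H G K j₀ l s s' j' ρ')
    (disjoint_blowupEdges_outerEdges H G K j₀ l s' s j ρ)
  have h4 := (Nat.cast_le (α := ℝ)).2 h3
  push_cast at h4 ⊢
  linarith

end Blowup

/-! ### Lower bound for the tail by planting the blow-up -/

section Planting

variable {V : Type u} [Fintype V] {X α : Type} [Fintype X] [Fintype α] {r n : ℕ}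

/-- The copies of `H` extending a given placement of the blow-up are distinct. -/
theorem card_extensions_le_count {H : SimpleGraph V} {G K : Finset V} {j₀ : X} {l : V → Fin r}
    (hl : ∀ u v, H.Adj u v → u ∈ K → v ∈ K → u ∉ G → v ∉ G → l u = l v)
    (hsurj : ∀ i, ∃ u ∈ K, u ∉ G ∧ l u = i) (ι : V × X × α ↪ Fin n) (s : V × X → α)
    (Γ : SimpleGraph (Fin n)) :
    (∑ c : (Fin r → X) × ({u // u ∉ K} → X × α),
      if ∀ e ∈ (blowupEdges H G K j₀ s ∪ outerEdges H G K j₀ l s c.1 c.2).map ι.sym2Map,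
        e ∈ Γ.edgeSet then (1 : ℝ) else 0) ≤ count H n Γ := by
  rw [Finset.sum_boole, count, copyCount_eq_card_copyKeys, Nat.cast_le]
  let Ψ : (Fin r → X) × ({u // u ∉ K} → X × α) → (V ↪ Fin n) := fun c =>
    ⟨fun u => ι (embed G K j₀ l s c.1 c.2 u), fun _ _ h => embed_inj _ _ (ι.injective h)⟩
  have hΨ : ∀ c c', copyKey H (Ψ c) = copyKey H (Ψ c') →
      ∀ u, embed G K j₀ l s c.1 c.2 u = embed G K j₀ l s c'.1 c'.2 u := by
    intro c c' h u
    have h1 : Ψ c u ∈ Finset.univ.map (Ψ c') := by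
      have : (copyKey H (Ψ c)).1 = (copyKey H (Ψ c')).1 := congrArg Prod.fst h
      simp only [copyKey] at this
      rw [← this]; simp
    obtain ⟨u', -, hu'⟩ := Finset.mem_map.1 h1
    have h2 := ι.injective hu'
    obtain rfl := embed_inj _ _ h2
    exact h2.symm
  refine Finset.card_le_card_of_injOn (fun c => copyKey H (Ψ c)) ?_ ?_
  · intro c hc
    simp only [Finset.coe_filter, Finset.mem_univ, true_and, Set.mem_ofPred_eq] at hc
    rw [Finset.mem_coe, Finset.mem_filter]
    refine ⟨Finset.mem_image_of_mem _ (Finset.mem_univ _), fun e he => ?_⟩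
    simp only [copyKey, Finset.mem_map] at he
    obtain ⟨d, hd, rfl⟩ := he
    refine hc _ (Finset.mem_map.2 ⟨_, map_embed_mem hl s c.1 c.2 hd, ?_⟩)
    simp only [Function.Embedding.sym2Map_apply, Sym2.map_map]
    rfl
  · rintro ⟨j, ρ⟩ - ⟨j', ρ'⟩ - h
    have h' := hΨ _ _ h
    refine Prod.ext (funext fun i => ?_) (funext fun u => ?_)
    -- A vertex of the `i`-th petal outside the root reveals the label chosen for that petal.
    · obtain ⟨u, huK, huG, rfl⟩ := hsurj i
      have := congrArg (fun y => y.2.1) (h' u)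
      simpa [embed, huK, place, label, huG] using this
    · have := h' u
      simpa [embed, u.2] using this

/-- Lower bound for the upper tail by planting a blow-up. -/
theorem planting_bound {p : I} (hp : 0 < (p : ℝ)) {H : SimpleGraph V} {m : ℝ} (hm : 0 ≤ m)
    {G K : Finset V} (j₀ : X) {l : V → Fin r}
    (hden : ∀ B : Finset V, ((edgesIn H B).card : ℝ) ≤ m * B.card)
    (hG : ((edgesIn H G).card : ℝ) = m * G.card) (hK : ((edgesIn H K).card : ℝ) = m * K.card)
    (hl : ∀ u v, H.Adj u v → u ∈ K → v ∈ K → u ∉ G → v ∉ G → l u = l v)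
    (hsurj : ∀ i, ∃ u ∈ K, u ∉ G ∧ l u = i) [Nonempty α] (ι : V × X × α ↪ Fin n) {a : ℝ}
    (ha : a ≤ (Fintype.card X : ℝ) ^ r *
      ((Fintype.card X * Fintype.card α : ℕ) : ℝ) ^ Fintype.card {u // u ∉ K} *
      (p : ℝ) ^ (edgesOut H K).card / 2) :
    1 ≤ 4 * tailProb H n p a *
      ((1 + (p : ℝ) ^ (-m) / Fintype.card α) ^ (Fintype.card V * Fintype.card X) *
      (1 + (p : ℝ) ^ (-m) / (Fintype.card X * Fintype.card α : ℕ)) ^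
        Fintype.card {u // u ∉ K}) := by
  have : Nonempty X := ⟨j₀⟩
  set q : ℝ := (p : ℝ) ^ (-m) with hq
  have hq0 : 0 ≤ q := by positivity
  set x := Fintype.card X
  set N := Fintype.card α
  have hx : 0 < x := Fintype.card_pos
  have hN : 0 < N := Fintype.card_pos
  -- An index is a placement of the blow-up, a choice of petal copies and positions outside `K`. The
  -- placement also moves pairs that the blow-up does not use; this only weakens the bound by extra
  -- factors.
  let E : (V × X → α) × (Fin r → X) × ({u // u ∉ K} → X × α) → Finset (Sym2 (Fin n)) := fun c =>
    (blowupEdges H G K j₀ c.1 ∪ outerEdges H G K j₀ l c.1 c.2.1 c.2.2).map ι.sym2Map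
  have hEd : ∀ t, ∀ e ∈ E t, ¬ e.IsDiag := by
    intro t e he
    obtain ⟨d, hd, rfl⟩ := Finset.mem_map.1 he
    rw [Function.Embedding.sym2Map_apply, Sym2.isDiag_map ι.injective]
    rcases Finset.mem_union.1 hd with hd | hd
    exacts [blowupEdges_not_isDiag d hd, outerEdges_not_isDiag d hd]
  have hEL : ∀ t, (E t).card = (blowup H G K j₀).card + (edgesOut H K).card := by
    intro t
    rw [Finset.card_map, Finset.card_union_of_disjoint (disjoint_blowupEdges_outerEdges ..),
      card_blowupEdges, card_outerEdges]
  have hcard : (Fintype.card ((V × X → α) × (Fin r → X) × ({u // u ∉ K} → X × α)) : ℝ)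
      = (N : ℝ) ^ (Fintype.card V * x) * ((x : ℝ) ^ r *
        ((x * N : ℕ) : ℝ) ^ Fintype.card {u // u ∉ K}) := by
    simp [x, N]
  have main := second_moment_family p hp E hEd _ hEL {Γ | a ≤ count H n Γ} ?_
  · have hsum : ∑ t, ∑ t', ((p : ℝ) ^ (E t ∩ E t').card)⁻¹ ≤
        ((x : ℝ) ^ r) ^ 2 *
        ((((N : ℝ) ^ (Fintype.card V * x)) ^ 2 * (1 + q / N) ^ (Fintype.card V * x)) *
        ((((x * N : ℕ) : ℝ) ^ Fintype.card {u // u ∉ K}) ^ 2 *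
          (1 + q / (x * N : ℕ)) ^ Fintype.card {u // u ∉ K})) := by
      have h1 : ∀ t t', ((p : ℝ) ^ (E t ∩ E t').card)⁻¹
          ≤ q ^ (agree t.1 t'.1).card * q ^ (agree t.2.2 t'.2.2).card := by
        intro t t'
        have h2 : ((E t ∩ E t').card : ℝ) ≤
            m * ((agree t.1 t'.1).card + (agree t.2.2 t'.2.2).card : ℕ) := by
          rw [← Finset.map_inter, Finset.card_map]
          exact card_inter_le hm j₀ hden hG hK l _ _ _ _ _ _
        rw [← pow_add, hq, ← Real.rpow_natCast (_ ^ _), ← Real.rpow_mul hp.le, ← Real.rpow_natCast,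
          ← Real.rpow_neg hp.le]
        exact Real.rpow_le_rpow_of_exponent_ge hp p.2.2 (by linarith)
      have h3 := sum_agree_le (ι := V × X) (α := α) q hq0
      have h4 := sum_agree_le (ι := {u // u ∉ K}) (α := X × α) q hq0
      simp only [Fintype.card_prod] at h3 h4
      calc ∑ t, ∑ t', ((p : ℝ) ^ (E t ∩ E t').card)⁻¹
          ≤ ∑ t : (V × X → α) × (Fin r → X) × ({u // u ∉ K} → X × α),
            ∑ t' : (V × X → α) × (Fin r → X) × ({u // u ∉ K} → X × α),
              q ^ (agree t.1 t'.1).card * q ^ (agree t.2.2 t'.2.2).card :=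
            Finset.sum_le_sum fun t _ => Finset.sum_le_sum fun t' _ => h1 t t'
        _ = ((x : ℝ) ^ r) ^ 2 *
            ((∑ f : V × X → α, ∑ g : V × X → α, q ^ (agree f g).card) *
            (∑ f : {u // u ∉ K} → X × α, ∑ g : {u // u ∉ K} → X × α, q ^ (agree f g).card)) := by
          simp only [Fintype.sum_prod_type, Finset.sum_const, Finset.card_univ, nsmul_eq_mul,
            ← Finset.mul_sum, ← Finset.sum_mul, Fintype.card_pi, Finset.prod_const,
            Fintype.card_fin, Nat.cast_pow]
          ring
        _ ≤ _ := by
          gcongr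
    have hP : 0 ≤ tailProb H n p a := measureReal_nonneg
    rw [hcard] at main
    have hpos : (0 : ℝ) < ((N : ℝ) ^ (Fintype.card V * x) * ((x : ℝ) ^ r *
        ((x * N : ℕ) : ℝ) ^ Fintype.card {u // u ∉ K})) ^ 2 := by positivity
    refine le_of_mul_le_mul_right ?_ hpos
    rw [one_mul]
    refine main.trans ((mul_le_mul_of_nonneg_left hsum (by positivity)).trans_eq ?_)
    simp only [tailProb]
    ring
  · rw [hcard]
    calc ∑ Γ, (SimpleGraph.binomialRandom (Fin n) p).real {Γ} *
          (if Γ ∈ {Γ | a ≤ count H n Γ} then 0 else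
            ∑ t, if ∀ e ∈ E t, e ∈ Γ.edgeSet then (1 : ℝ) else 0)
        ≤ ∑ Γ, (SimpleGraph.binomialRandom (Fin n) p).real {Γ} *
          (∑ s : V × X → α, (if ∀ e ∈ (blowupEdges H G K j₀ s).map ι.sym2Map, e ∈ Γ.edgeSet
            then (1 : ℝ) else 0) * ((x : ℝ) ^ r *
        ((x * N : ℕ) : ℝ) ^ Fintype.card {u // u ∉ K} * (p : ℝ) ^ (edgesOut H K).card / 2)) := by
          refine Finset.sum_le_sum fun Γ _ => mul_le_mul_of_nonneg_left ?_ measureReal_nonneg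
          split_ifs with hΓ
          · exact Finset.sum_nonneg fun s _ => mul_nonneg (by split_ifs <;> simp) (by positivity)
          -- Off the tail event a present blow-up has fewer than `a` extensions, which is at most
          -- half of their expected number; an absent blow-up contributes nothing.
          · rw [Set.mem_ofPred_eq, not_le] at hΓ
            rw [Fintype.sum_prod_type]
            refine Finset.sum_le_sum fun s _ => ?_
            split_ifs with hs
            · rw [one_mul]
              exact (card_extensions_le_count hl hsurj ι s Γ).trans (hΓ.le.trans ha)
            · rw [zero_mul]
              refine (Finset.sum_eq_zero fun c _ => if_neg fun h => hs fun e he => h e ?_).le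
              exact Finset.map_subset_map.2 Finset.subset_union_left he
      _ = (N : ℝ) ^ (Fintype.card V * x) * (p : ℝ) ^ (blowup H G K j₀).card * ((x : ℝ) ^ r *
        ((x * N : ℕ) : ℝ) ^ Fintype.card {u // u ∉ K} * (p : ℝ) ^ (edgesOut H K).card / 2) := by
          simp_rw [← Finset.sum_mul, ← mul_assoc, ← Finset.sum_mul, Finset.mul_sum]
          rw [Finset.sum_comm]
          have h5 : ∀ s : V × X → α, ∑ Γ, (SimpleGraph.binomialRandom (Fin n) p).real {Γ} *
              (if ∀ e ∈ (blowupEdges H G K j₀ s).map ι.sym2Map, e ∈ Γ.edgeSet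
                then (1 : ℝ) else 0) = (p : ℝ) ^ (blowup H G K j₀).card := by
            intro s
            rw [integral_indicator_superset, Finset.card_map, card_blowupEdges]
            intro e he
            obtain ⟨d, hd, rfl⟩ := Finset.mem_map.1 he
            rw [Function.Embedding.sym2Map_apply, Sym2.isDiag_map ι.injective]
            exact blowupEdges_not_isDiag d hd
          simp_rw [h5]
          simp [x, N]
      _ ≤ _ := by
          rw [pow_add]
          exact le_of_eq (by ring)

end Planting

/-! ### The lattice structure of primal subgraphs -/

section Primal

variable {V : Type u} [Fintype V] {H : SimpleGraph V}

/-- The vertex set of a subgraph as a finset. -/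
noncomputable def vertFinset (F : H.Subgraph) : Finset V := F.verts.toFinset

theorem mem_vertFinset {F : H.Subgraph} {u : V} : u ∈ vertFinset F ↔ u ∈ F.verts := by
  simp [vertFinset]

theorem ncard_verts (F : H.Subgraph) : F.verts.ncard = (vertFinset F).card :=
  Set.ncard_eq_toFinset_card' _

theorem edgeSet_subset_edgesIn (F : H.Subgraph) : F.edgeSet ⊆ edgesIn H (vertFinset F) := by
  intro e he
  simp only [edgesIn, Finset.coe_filter, SimpleGraph.mem_edgeFinset, Set.mem_ofPred_eq,
    mem_vertFinset]
  exact ⟨F.edgeSet_subset he, fun u hu => F.mem_verts_of_mem_edge he hu⟩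

theorem ncard_edgeSet_le (F : H.Subgraph) : F.edgeSet.ncard ≤ (edgesIn H (vertFinset F)).card := by
  rw [← Set.ncard_coe_finset]
  exact Set.ncard_le_ncard (edgeSet_subset_edgesIn F)

/-- The subgraph of `H` induced by a finset. -/
def inducedOn (H : SimpleGraph V) (B : Finset V) : H.Subgraph := (⊤ : H.Subgraph).induce B

theorem vertFinset_inducedOn (B : Finset V) : vertFinset (inducedOn H B) = B := by
  ext u; simp [mem_vertFinset, inducedOn]

theorem edgeSet_inducedOn (B : Finset V) : (inducedOn H B).edgeSet = edgesIn H B := by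
  ext e
  induction e using Sym2.ind with | _ u v =>
  simp [inducedOn, edgesIn]
  tauto

theorem le_inducedOn {F : H.Subgraph} {B : Finset V} (h : vertFinset F ⊆ B) :
    F ≤ inducedOn H B := by
  refine ⟨fun u hu => by simpa [inducedOn] using h (mem_vertFinset.2 hu), fun u v huv => ?_⟩
  have h1 := h (mem_vertFinset.2 huv.fst_mem)
  have h2 := h (mem_vertFinset.2 huv.snd_mem)
  simp [inducedOn, h1, h2, huv.adj_sub]

theorem density_le_maxDensity {F : H.Subgraph} (hF : F.verts.Nonempty) :
    density F ≤ maxDensity H :=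
  le_ciSup (f := fun F : {F : H.Subgraph // F.verts.Nonempty} => density F.1)
    (Set.finite_range _).bddAbove ⟨F, hF⟩

theorem card_edgesIn_le (B : Finset V) :
    ((edgesIn H B).card : ℝ) ≤ maxDensity H * B.card := by
  rcases B.eq_empty_or_nonempty with rfl | hB
  · have : edgesIn H (∅ : Finset V) = ∅ := by
      refine Finset.filter_eq_empty_iff.2 fun e _ h => ?_
      induction e using Sym2.ind with | _ u v => simpa using h u
    simp [this]
  · have h := density_le_maxDensity (F := inducedOn H B) (by simpa [inducedOn] using hB)
    have hpos : (0 : ℝ) < B.card := by exact_mod_cast hB.card_pos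
    rwa [density, edgeSet_inducedOn, ncard_verts, vertFinset_inducedOn, Set.ncard_coe_finset,
      div_le_iff₀ hpos] at h

theorem maxDensity_pos (hH : H.edgeSet.Nonempty) : 0 < maxDensity H := by
  obtain ⟨e, he⟩ := hH
  have h := card_edgesIn_le (H := H) Finset.univ
  have h1 : 0 < (edgesIn H Finset.univ).card :=
    Finset.card_pos.2 ⟨e, Finset.mem_filter.2 ⟨by simpa using he, by simp⟩⟩
  have h2 : (0 : ℝ) < (edgesIn H Finset.univ).card := by exact_mod_cast h1
  by_contra h3
  have := mul_nonpos_of_nonpos_of_nonneg (not_lt.1 h3)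
    (Nat.cast_nonneg (α := ℝ) (Finset.univ : Finset V).card)
  linarith

/-- A vertex set inducing a subgraph of maximum density (or the empty set). -/
def IsTight (H : SimpleGraph V) (B : Finset V) : Prop :=
  ((edgesIn H B).card : ℝ) = maxDensity H * B.card

theorem isPrimal_inducedOn {B : Finset V} (hB : B.Nonempty) (h : IsTight H B) :
    IsPrimal (inducedOn H B) := by
  refine ⟨by simpa [inducedOn] using hB, ?_⟩
  have hpos : (0 : ℝ) < B.card := by exact_mod_cast hB.card_pos
  rw [density, edgeSet_inducedOn, ncard_verts, vertFinset_inducedOn, Set.ncard_coe_finset,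
    div_eq_iff hpos.ne']
  exact h

theorem IsPrimal.vertFinset_nonempty {F : H.Subgraph} (hF : IsPrimal F) :
    (vertFinset F).Nonempty := by
  obtain ⟨u, hu⟩ := hF.1
  exact ⟨u, mem_vertFinset.2 hu⟩

theorem IsPrimal.ncard_edgeSet {F : H.Subgraph} (hF : IsPrimal F) :
    (F.edgeSet.ncard : ℝ) = maxDensity H * (vertFinset F).card := by
  have hpos : (0 : ℝ) < (vertFinset F).card := by exact_mod_cast hF.vertFinset_nonempty.card_pos
  have h := hF.2
  rwa [density, ncard_verts, div_eq_iff hpos.ne'] at h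

theorem IsPrimal.isTight {F : H.Subgraph} (hF : IsPrimal F) : IsTight H (vertFinset F) := by
  refine le_antisymm (card_edgesIn_le _) ?_
  rw [← hF.ncard_edgeSet]
  exact Nat.cast_le.2 (ncard_edgeSet_le F)

/-- An edge of H missing inside `F` would push the density above the maximum. Primal subgraphs are
thus determined by their vertex sets. -/
theorem IsPrimal.eq_inducedOn {F : H.Subgraph} (hF : IsPrimal F) :
    F = inducedOn H (vertFinset F) := by
  have h1 : F.edgeSet.ncard = (edgesIn H (vertFinset F)).card := by
    have : (F.edgeSet.ncard : ℝ) = (edgesIn H (vertFinset F)).card := by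
      rw [hF.ncard_edgeSet, hF.isTight]
    exact_mod_cast this
  have h2 : F.edgeSet = (edgesIn H (vertFinset F) : Set (Sym2 V)) :=
    Set.eq_of_subset_of_ncard_le (edgeSet_subset_edgesIn F) (by rw [Set.ncard_coe_finset, h1])
  rw [← edgeSet_inducedOn] at h2
  ext u v
  · rw [← mem_vertFinset, ← mem_vertFinset, vertFinset_inducedOn]
  · rw [← SimpleGraph.Subgraph.mem_edgeSet, h2, SimpleGraph.Subgraph.mem_edgeSet]

theorem card_edgesIn_supermodular (A B : Finset V) :
    (edgesIn H A).card + (edgesIn H B).card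
      + ((edgesIn H (A ∪ B)) \ (edgesIn H A ∪ edgesIn H B)).card
      = (edgesIn H (A ∪ B)).card + (edgesIn H (A ∩ B)).card := by
  have h1 : edgesIn H A ∩ edgesIn H B = edgesIn H (A ∩ B) := by
    ext e
    simp only [edgesIn, Finset.mem_inter, Finset.mem_filter]
    constructor
    · rintro ⟨⟨h1, h2⟩, -, h3⟩; exact ⟨h1, fun u hu => ⟨h2 u hu, h3 u hu⟩⟩
    · rintro ⟨h1, h2⟩; exact ⟨⟨h1, fun u hu => (h2 u hu).1⟩, h1, fun u hu => (h2 u hu).2⟩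
  have h2 : edgesIn H A ∪ edgesIn H B ⊆ edgesIn H (A ∪ B) := by
    intro e he
    simp only [edgesIn, Finset.mem_union, Finset.mem_filter] at he ⊢
    rcases he with he | he
    · exact ⟨he.1, fun u hu => Or.inl (he.2 u hu)⟩
    · exact ⟨he.1, fun u hu => Or.inr (he.2 u hu)⟩
  have h3 := Finset.card_sdiff_add_card_eq_card h2
  have h4 := Finset.card_union_add_card_inter (edgesIn H A) (edgesIn H B)
  rw [h1] at h4
  omega

/-- The density bounds for the union and the intersection, added to the supermodular identity, leave
no slack. Hence both are equalities and no edge joins A ∖ B to B ∖ A. -/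
theorem IsTight.union_inter {A B : Finset V} (hA : IsTight H A) (hB : IsTight H B) :
    IsTight H (A ∪ B) ∧ IsTight H (A ∩ B) ∧
      ((edgesIn H (A ∪ B)) \ (edgesIn H A ∪ edgesIn H B)).card = 0 := by
  have h1 := card_edgesIn_supermodular (H := H) A B
  have h2 := Finset.card_union_add_card_inter A B
  have h1' := congrArg (Nat.cast (R := ℝ)) h1
  have h2' := congrArg (Nat.cast (R := ℝ)) h2
  push_cast at h1' h2'
  have h3 := card_edgesIn_le (H := H) (A ∪ B)
  have h4 := card_edgesIn_le (H := H) (A ∩ B)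
  unfold IsTight at *
  have h5 : (0 : ℝ) ≤ ((edgesIn H (A ∪ B)) \ (edgesIn H A ∪ edgesIn H B)).card := Nat.cast_nonneg _
  have h6 : maxDensity H * ((A ∪ B).card : ℝ) + maxDensity H * ((A ∩ B).card : ℝ)
      = maxDensity H * A.card + maxDensity H * B.card := by
    rw [← mul_add, h2', mul_add]
  refine ⟨by linarith, by linarith, ?_⟩
  have : (((edgesIn H (A ∪ B)) \ (edgesIn H A ∪ edgesIn H B)).card : ℝ) = 0 := by linarith
  exact_mod_cast this

theorem isTight_empty : IsTight H ∅ := by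
  have h := card_edgesIn_le (H := H) ∅
  simp only [Finset.card_empty, Nat.cast_zero, mul_zero] at h
  simp only [IsTight, Finset.card_empty, Nat.cast_zero, mul_zero]
  exact le_antisymm h (Nat.cast_nonneg _)

theorem isTight_biUnion {ι : Type*} (S : Finset ι) (f : ι → Finset V)
    (h : ∀ i ∈ S, IsTight H (f i)) : IsTight H (S.biUnion f) := by
  induction S using Finset.induction_on with
  | empty => simpa using isTight_empty
  | insert i S _ ih =>
    rw [Finset.biUnion_insert]
    exact ((h i (Finset.mem_insert_self _ _)).union_inter
      (ih fun j hj => h j (Finset.mem_insert_of_mem hj))).1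

variable {G : H.Subgraph} {r : ℕ} {J : Fin r → H.Subgraph}

theorem vertFinset_mono {F F' : H.Subgraph} (h : F ≤ F') : vertFinset F ⊆ vertFinset F' :=
  fun _ hu => mem_vertFinset.2 (h.1 (mem_vertFinset.1 hu))

/-- Distinct primal covers of `G` intersect exactly in `G`. -/
theorem inter_of_covers (hG : IsPrimal G) {J J' : H.Subgraph} (hJ : IsPrimal J) (hJ' : IsPrimal J')
    (hc : Covers J G) (hc' : Covers J' G) (hne : J ≠ J') :
    vertFinset J ∩ vertFinset J' = vertFinset G := by
  by_contra hcon
  have hsub : vertFinset G ⊆ vertFinset J ∩ vertFinset J' :=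
    Finset.subset_inter (vertFinset_mono hc.1.le) (vertFinset_mono hc'.1.le)
  have ht := (hJ.isTight.union_inter hJ'.isTight).2.1
  set A := vertFinset J ∩ vertFinset J' with hA
  have hP : IsPrimal (inducedOn H A) := isPrimal_inducedOn (hG.vertFinset_nonempty.mono hsub) ht
  have hGA : G < inducedOn H A := by
    refine lt_of_le_of_ne (le_inducedOn hsub) fun h => hcon ?_
    rw [h, vertFinset_inducedOn]
  -- A larger intersection would be a primal subgraph strictly above `G` inside each cover, so it
  -- would equal both of them.
  have hlt : ∀ {F : H.Subgraph}, IsPrimal F → Covers F G → A ⊆ vertFinset F →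
      A = vertFinset F := by
    intro F hF hcF hAF
    by_contra hne
    refine hcF.2 _ hP ⟨hGA, lt_of_le_of_ne ?_ fun h => hne ?_⟩
    · rw [hF.eq_inducedOn]
      exact le_inducedOn (by rwa [vertFinset_inducedOn])
    · rw [← h, vertFinset_inducedOn]
  have h1 := hlt hJ hc Finset.inter_subset_left
  have h2 := hlt hJ' hc' Finset.inter_subset_right
  refine hne ?_
  rw [hJ.eq_inducedOn, hJ'.eq_inducedOn, ← h1, ← h2]

/-- There are no edges between the parts of distinct primal covers of `G` outside of `G`. -/
theorem not_adj_of_covers (hG : IsPrimal G) {J J' : H.Subgraph} (hJ : IsPrimal J)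
    (hJ' : IsPrimal J') (hc : Covers J G) (hc' : Covers J' G) (hne : J ≠ J') {u v : V}
    (hu : u ∈ vertFinset J) (hv : v ∈ vertFinset J') (huG : u ∉ vertFinset G)
    (hvG : v ∉ vertFinset G) : ¬ H.Adj u v := by
  intro hadj
  have h1 := inter_of_covers hG hJ hJ' hc hc' hne
  have h2 := Finset.card_eq_zero.1 (hJ.isTight.union_inter hJ'.isTight).2.2
  have h3 : s(u, v) ∉ (edgesIn H (vertFinset J ∪ vertFinset J')) \
    (edgesIn H (vertFinset J) ∪ edgesIn H (vertFinset J')) := by rw [h2]; simp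
  apply h3
  have hvJ : v ∉ vertFinset J := fun h => hvG (h1 ▸ Finset.mem_inter.2 ⟨h, hv⟩)
  have huJ : u ∉ vertFinset J' := fun h => huG (h1 ▸ Finset.mem_inter.2 ⟨hu, h⟩)
  simp [edgesIn, hadj, hu, hv, hvJ, huJ]

/-- A labelling of the vertices of the union of the covers of `G` by the covers. -/
theorem exists_label (hr : 1 ≤ r) (hG : IsPrimal G) (hJinj : Function.Injective J)
    (hJ : ∀ i, IsPrimal (J i)) (hJG : ∀ i, Covers (J i) G) :
    ∃ l : V → Fin r, (∀ u v, H.Adj u v → u ∈ vertFinset (⨆ i, J i) → v ∈ vertFinset (⨆ i, J i) →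
      u ∉ vertFinset G → v ∉ vertFinset G → l u = l v) ∧
      ∀ i, ∃ u ∈ vertFinset (⨆ i, J i), u ∉ vertFinset G ∧ l u = i := by
  have hmem : ∀ u, u ∈ vertFinset (⨆ i, J i) ↔ ∃ i, u ∈ vertFinset (J i) := by
    intro u; simp [mem_vertFinset]
  -- Outside `G` the petals are disjoint, so the choice is forced there. Values on `G` and the
  -- default value off the covers play no role.
  let l : V → Fin r := fun u => if h : ∃ i, u ∈ vertFinset (J i) then h.choose else ⟨0, hr⟩
  have hl : ∀ u i, u ∈ vertFinset (J i) → u ∉ vertFinset G → l u = i := by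
    intro u i hu huG
    have h : ∃ i, u ∈ vertFinset (J i) := ⟨i, hu⟩
    have h1 : l u = h.choose := dif_pos h
    rw [h1]
    by_contra hne
    refine huG ?_
    rw [← inter_of_covers hG (hJ _) (hJ i) (hJG _) (hJG i) (fun h' => hne (hJinj h'))]
    exact Finset.mem_inter.2 ⟨h.choose_spec, hu⟩
  refine ⟨l, ?_, ?_⟩
  · intro u v hadj hu hv huG hvG
    obtain ⟨i, hi⟩ := (hmem u).1 hu
    obtain ⟨k, hk⟩ := (hmem v).1 hv
    rw [hl u i hi huG, hl v k hk hvG]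
    by_contra hne
    exact not_adj_of_covers hG (hJ i) (hJ k) (hJG i) (hJG k) (fun h => hne (hJinj h)) hi hk huG hvG
      hadj
  · intro i
    have hss : ¬ vertFinset (J i) ⊆ vertFinset G := by
      intro hsub
      have : J i ≤ G := by
        rw [hG.eq_inducedOn]
        exact le_inducedOn hsub
      exact absurd (hJG i).1 (not_lt_of_ge this)
    obtain ⟨u, hu, huG⟩ := Finset.not_subset.1 hss
    exact ⟨u, (hmem u).2 ⟨i, hu⟩, huG, hl u i hu huG⟩

theorem isTight_iSup (hJ : ∀ i, IsPrimal (J i)) : IsTight H (vertFinset (⨆ i, J i)) := by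
  have : vertFinset (⨆ i, J i) = Finset.univ.biUnion fun i => vertFinset (J i) := by
    ext u; simp [mem_vertFinset]
  rw [this]
  exact isTight_biUnion _ _ fun i _ => (hJ i).isTight

end Primal

/-! ### Lower bounds for the expectations of subgraphs -/

section Expectation

variable {V : Type u} [Fintype V] {H : SimpleGraph V}

/-- Below a small power of `n`, all subgraphs of `H` have expectation at least a power of `ω`. -/
theorem exists_pow_le_expectation (hm : 0 < maxDensity H) {s : ℝ} (hs : 0 < s)
    (hsB : ∀ B : Finset V, B.Nonempty → IsTight H B → s ≤ B.card) :
    ∃ β₀ : ℝ, 0 < β₀ ∧ ∀ (n : ℕ) (p : I), 1 ≤ omega H n p → omega H n p ≤ (n : ℝ) ^ β₀ →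
      ∀ B : Finset V, B.Nonempty →
        omega H n p ^ s ≤ (n : ℝ) ^ B.card * (p : ℝ) ^ (edgesIn H B).card := by
  -- `δ` is a common lower bound for the deficits of the finitely many sets that are not tight;
  -- tight sets get the dummy value 1.
  obtain ⟨δ, hδ, hδB⟩ : ∃ δ : ℝ, 0 < δ ∧ ∀ B : Finset V, ¬ IsTight H B →
      δ ≤ maxDensity H * B.card - (edgesIn H B).card := by
    have h : ∀ B : Finset V, ∃ δ : ℝ, 0 < δ ∧ (¬ IsTight H B →
        δ ≤ maxDensity H * B.card - (edgesIn H B).card) := by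
      intro B
      by_cases hB : IsTight H B
      · exact ⟨1, one_pos, fun h => absurd hB h⟩
      · exact ⟨_, sub_pos.2 (lt_of_le_of_ne (card_edgesIn_le B) hB), fun _ => le_rfl⟩
    choose d hd hd' using h
    obtain ⟨B₀, -, hB₀⟩ := Finset.exists_min_image Finset.univ d Finset.univ_nonempty
    exact ⟨d B₀, hd _, fun B hB => (hB₀ B (Finset.mem_univ _)).trans (hd' B hB)⟩
  set m := maxDensity H with hmdef
  -- The exponent ensures ω^(1+sm/δ) ≤ n. Cancelling n from ω = n p^m leaves ω^(sm/δ) ≤ p^(-m), that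
  -- is ω^s ≤ p^(-δ), which the deficit of a set that is not tight supplies.
  refine ⟨(1 + s * m / δ)⁻¹, by positivity, fun n p h1 h2 B hB => ?_⟩
  set w := omega H n p with hw
  have hw0 : 0 < w := by linarith
  have hn0 : 0 < (n : ℝ) := by
    rcases (Nat.cast_nonneg (α := ℝ) n).eq_or_lt' with h | h
    · rw [hw, omega, h, zero_mul] at hw0; exact absurd hw0 (lt_irrefl _)
    · exact h
  have hp0 : 0 < (p : ℝ) := by
    rcases p.2.1.eq_or_lt' with h | h
    · rw [hw, omega, h, Real.zero_rpow hm.ne', mul_zero] at hw0; exact absurd hw0 (lt_irrefl _)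
    · exact h
  have hpow : (n : ℝ) ^ B.card * (p : ℝ) ^ (edgesIn H B).card
      = w ^ (B.card : ℝ) * (p : ℝ) ^ (-(m * B.card - (edgesIn H B).card)) := by
    rw [hw, omega, Real.mul_rpow hn0.le (by positivity), ← Real.rpow_mul hp0.le, mul_assoc,
      ← Real.rpow_add hp0, Real.rpow_natCast, ← Real.rpow_natCast (p : ℝ)]
    congr 2
    rw [← hmdef]; ring
  rw [hpow]
  by_cases hT : IsTight H B
  · have : m * B.card - (edgesIn H B).card = 0 := by
      unfold IsTight at hT; rw [hT]; ring
    rw [this, neg_zero, Real.rpow_zero, mul_one]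
    exact Real.rpow_le_rpow_of_exponent_le h1 (hsB B hB hT)
  · have h3 := hδB B hT
    have h4 : w ^ s ≤ (p : ℝ) ^ (-δ) := by
      have h5 : w ^ (1 + s * m / δ) ≤ n := by
        calc w ^ (1 + s * m / δ) ≤ ((n : ℝ) ^ (1 + s * m / δ)⁻¹) ^ (1 + s * m / δ) :=
              Real.rpow_le_rpow hw0.le h2 (by positivity)
          _ = n := Real.rpow_inv_rpow hn0.le (by positivity)
      rw [Real.rpow_add hw0, Real.rpow_one] at h5
      nth_rewrite 1 [hw] at h5
      rw [omega, mul_assoc] at h5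
      have h6 : (p : ℝ) ^ m * w ^ (s * m / δ) ≤ 1 := by
        refine le_of_mul_le_mul_left ?_ hn0
        rwa [mul_one]
      have h7 : w ^ (s * m / δ) ≤ (p : ℝ) ^ (-m) := by
        rw [Real.rpow_neg hp0.le]
        rwa [← one_div, le_div_iff₀ (by positivity), mul_comm]
      calc w ^ s = (w ^ (s * m / δ)) ^ (δ / m) := by
            rw [← Real.rpow_mul hw0.le]; congr 1; field_simp
        _ ≤ ((p : ℝ) ^ (-m)) ^ (δ / m) := Real.rpow_le_rpow (by positivity) h7 (by positivity)
        _ = (p : ℝ) ^ (-δ) := by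
            rw [← Real.rpow_mul hp0.le]; congr 1; field_simp
    calc w ^ s ≤ (p : ℝ) ^ (-δ) := h4
      _ ≤ (p : ℝ) ^ (-(m * B.card - (edgesIn H B).card)) :=
          Real.rpow_le_rpow_of_exponent_ge hp0 p.2.2 (by linarith)
      _ ≤ _ := le_mul_of_one_le_left (by positivity)
          (Real.one_le_rpow h1 (by positivity))

end Expectation

/-! ### Bounds for the mean, the variance, Φ and M -/

section Moments

theorem natDiv_lower {n d : ℕ} (hd : 0 < d) (h : d ≤ n) :
    (n : ℝ) / (2 * d) ≤ ((n / d : ℕ) : ℝ) := by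
  have h1 : n < d * (n / d + 1) := Nat.lt_mul_div_succ n hd
  have h2 : 1 ≤ n / d := (Nat.one_le_div_iff hd).2 h
  rw [div_le_iff₀ (by positivity)]
  have h3 : (n : ℝ) < d * ((n / d : ℕ) + 1) := by exact_mod_cast h1
  have h4 : (1 : ℝ) ≤ (n / d : ℕ) := by exact_mod_cast h2
  have h5 : (0 : ℝ) < d := by exact_mod_cast hd
  nlinarith

/-- The constant depends on `v` alone, so it serves all subgraphs of a graph on `v` vertices at
once. -/
theorem mean_lower {W : Type u} [Fintype W] (F : SimpleGraph W) {n v : ℕ} (p : I)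
    (hW : 0 < Fintype.card W) (hv : Fintype.card W ≤ v) (hn : v ≤ n) :
    ((2 * v : ℝ) ^ v)⁻¹ * ((n : ℝ) ^ Fintype.card W * (p : ℝ) ^ F.edgeFinset.card)
      ≤ mean F n p := by
  rw [mean_eq, ← mul_assoc]
  refine mul_le_mul_of_nonneg_right ?_ (pow_nonneg p.2.1 _)
  have h1 := pow_le_card_copyKeys F (n := n) (N := n / Fintype.card W) (Nat.mul_div_le _ _)
  have h2 := natDiv_lower hW (hv.trans hn)
  have hvpos : (0 : ℝ) < v := by exact_mod_cast hW.trans_le hv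
  have hWpos : (0 : ℝ) < Fintype.card W := by exact_mod_cast hW
  have hWv : (Fintype.card W : ℝ) ≤ v := by exact_mod_cast hv
  have hv1 : (1 : ℝ) ≤ v := by exact_mod_cast (Nat.succ_le_of_lt hW).trans hv
  calc ((2 * v : ℝ) ^ v)⁻¹ * (n : ℝ) ^ Fintype.card W
      ≤ ((2 * v : ℝ) ^ Fintype.card W)⁻¹ * (n : ℝ) ^ Fintype.card W := by
        refine mul_le_mul_of_nonneg_right (inv_anti₀ (by positivity) ?_) (by positivity)
        exact pow_le_pow_right₀ (by linarith) hv
    _ = ((n : ℝ) / (2 * v)) ^ Fintype.card W := by rw [div_pow]; ring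
    _ ≤ (((n / Fintype.card W : ℕ) : ℝ)) ^ Fintype.card W := by
        refine pow_le_pow_left₀ (by positivity) (le_trans ?_ h2) _
        gcongr
    _ ≤ _ := by exact_mod_cast h1

theorem mean_upper {W : Type u} [Fintype W] (F : SimpleGraph W) (n : ℕ) (p : I) :
    mean F n p ≤ (n : ℝ) ^ Fintype.card W * (p : ℝ) ^ F.edgeFinset.card := by
  rw [mean_eq]
  refine mul_le_mul_of_nonneg_right ?_ (pow_nonneg p.2.1 _)
  exact_mod_cast card_copyKeys_le F n

variable {V : Type u} {H : SimpleGraph V}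

theorem card_edgeFinset_coe (F : H.Subgraph) [Fintype F.coe.edgeSet] :
    F.coe.edgeFinset.card = F.edgeSet.ncard := by
  rw [← Set.ncard_coe_finset, SimpleGraph.coe_edgeFinset,
    ← Set.ncard_image_of_injective F.coe.edgeSet (Sym2.map.injective Subtype.coe_injective)]
  congr 1
  ext e
  constructor
  · rintro ⟨d, hd, rfl⟩
    induction d using Sym2.ind with | _ a b => simpa using hd
  · intro he
    induction e using Sym2.ind with | _ a b =>
    have hab : F.Adj a b := he
    exact ⟨s(⟨a, hab.fst_mem⟩, ⟨b, hab.snd_mem⟩), by simpa using hab, rfl⟩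

variable [Fintype V]

/-- Uniform lower bound for the expectations of the subgraphs of `H` with an edge. -/
theorem mean_subgraph_lower {n : ℕ} {p : I} {y : ℝ} (hn : Fintype.card V ≤ n)
    (hB : ∀ B : Finset V, B.Nonempty → y ≤ (n : ℝ) ^ B.card * (p : ℝ) ^ (edgesIn H B).card)
    (F : H.Subgraph) (hF : F.edgeSet.Nonempty) :
    ((2 * Fintype.card V : ℝ) ^ Fintype.card V)⁻¹ * y ≤ mean F.coe n p := by
  have hne : F.verts.Nonempty := by
    obtain ⟨e, he⟩ := hF
    induction e using Sym2.ind with | _ a b =>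
    have hab : F.Adj a b := he
    exact ⟨a, hab.fst_mem⟩
  have hne' : (vertFinset F).Nonempty := by
    obtain ⟨u, hu⟩ := hne; exact ⟨u, mem_vertFinset.2 hu⟩
  have hc : Fintype.card F.verts = (vertFinset F).card := by
    rw [vertFinset, Set.toFinset_card]
  have h1 := mean_lower F.coe (n := n) (v := Fintype.card V) p (by rw [hc]; exact hne'.card_pos)
    (by rw [hc]; exact Finset.card_le_univ _) hn
  refine le_trans (mul_le_mul_of_nonneg_left ((hB _ hne').trans ?_) (by positivity)) h1
  rw [hc, card_edgeFinset_coe]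
  refine mul_le_mul_of_nonneg_left ?_ (by positivity)
  exact pow_le_pow_of_le_one p.2.1 p.2.2 (ncard_edgeSet_le F)

theorem Phi_lower (hH : H.edgeSet.Nonempty) {n : ℕ} {p : I} {y : ℝ} (hn : Fintype.card V ≤ n)
    (hB : ∀ B : Finset V, B.Nonempty → y ≤ (n : ℝ) ^ B.card * (p : ℝ) ^ (edgesIn H B).card) :
    ((2 * Fintype.card V : ℝ) ^ Fintype.card V)⁻¹ * y ≤ Phi H n p := by
  have : Nonempty {F : H.Subgraph // F.edgeSet.Nonempty} := ⟨⊤, by simpa using hH⟩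
  exact le_ciInf fun F => mean_subgraph_lower hn hB F.1 F.2

theorem fracIndepNum_nonneg {W : Type u} [Fintype W] (F : SimpleGraph W) : 0 ≤ fracIndepNum F := by
  refine Real.sSup_nonneg ?_
  rintro _ ⟨f, hf, -, rfl⟩
  exact Finset.sum_nonneg fun v _ => (hf v).1

/-- This crude bound suffices because the factor log(1/p) is already large enough. In the second
range p^Δ ≥ 1/n, so n² p^Δ ≥ n. -/
theorem one_le_M (hH : H.edgeSet.Nonempty) {n : ℕ} {p : I} (hn : 1 ≤ n)
    (h : ∀ F : H.Subgraph, F.edgeSet.Nonempty → 1 ≤ mean F.coe n p) : 1 ≤ M H n p := by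
  have hn' : (1 : ℝ) ≤ n := by exact_mod_cast hn
  unfold M
  split_ifs with hp
  · have : Nonempty {F : H.Subgraph // F.edgeSet.Nonempty} := ⟨⊤, by simpa using hH⟩
    refine le_ciInf fun F => Real.one_le_rpow (h F.1 F.2) ?_
    exact one_div_nonneg.2 (fracIndepNum_nonneg _)
  · rw [not_lt] at hp
    generalize H.maxDegree = D at hp ⊢
    have h1 : (n : ℝ)⁻¹ ≤ (p : ℝ) ^ D := by
      rcases Nat.eq_zero_or_pos D with rfl | hD
      · simpa using inv_le_one_of_one_le₀ hn'
      · have hD' : (0 : ℝ) < D := by exact_mod_cast hD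
        calc (n : ℝ)⁻¹ = ((n : ℝ) ^ (-(1 / (D : ℝ)))) ^ D := by
              rw [← Real.rpow_natCast, ← Real.rpow_mul (by positivity), ← Real.rpow_neg_one]
              congr 1; field_simp
          _ ≤ _ := pow_le_pow_left₀ (by positivity) hp _
    calc (1 : ℝ) ≤ n := hn'
      _ = (n : ℝ) ^ 2 * (n : ℝ)⁻¹ := by field_simp
      _ ≤ _ := mul_le_mul_of_nonneg_left h1 (by positivity)

theorem sum_image_le_of_nonneg {ι κ : Type*} [DecidableEq κ] (S : Finset ι) (g : ι → κ) (f : κ → ℝ)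
    (hf : ∀ k, 0 ≤ f k) : ∑ k ∈ S.image g, f k ≤ ∑ i ∈ S, f (g i) := by
  rw [← Finset.sum_fiberwise_of_maps_to (fun i hi => Finset.mem_image_of_mem g hi)]
  refine Finset.sum_le_sum fun k hk => ?_
  obtain ⟨i, hi, rfl⟩ := Finset.mem_image.1 hk
  exact Finset.single_le_sum (f := fun j => f (g j)) (fun j _ => hf _)
    (Finset.mem_filter.2 ⟨hi, rfl⟩)

/-- The variance of the number of copies as a sum over pairs of intersecting copies. -/
theorem variance_count_le (H : SimpleGraph V) (n : ℕ) {p : I} (hp : 0 < (p : ℝ)) :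
    variance (count H n) (SimpleGraph.binomialRandom (Fin n) p) ≤
      (p : ℝ) ^ (2 * H.edgeFinset.card) * ∑ k ∈ copyKeys H n, ∑ k' ∈ copyKeys H n,
        if (k.2 ∩ k'.2).Nonempty then ((p : ℝ) ^ (k.2 ∩ k'.2).card)⁻¹ else 0 := by
  rw [variance_eq_sub MemLp.of_discrete]
  have hm : ∫ Γ, count H n Γ ∂(SimpleGraph.binomialRandom (Fin n) p)
      = (copyKeys H n).card * (p : ℝ) ^ H.edgeFinset.card := mean_eq H n p
  rw [hm, integral_eq_weighted_sum]
  have hk : ∀ k ∈ copyKeys H n, (∀ e ∈ k.2, ¬ e.IsDiag) ∧ k.2.card = H.edgeFinset.card := by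
    intro k hk
    obtain ⟨φ, -, rfl⟩ := Finset.mem_image.1 hk
    exact ⟨copyKey_snd_not_isDiag H φ, copyKey_snd_card H φ⟩
  have h2 : ∑ Γ, (SimpleGraph.binomialRandom (Fin n) p).real {Γ} * (count H n ^ 2) Γ
      = (p : ℝ) ^ (2 * H.edgeFinset.card) * ∑ k ∈ copyKeys H n, ∑ k' ∈ copyKeys H n,
        ((p : ℝ) ^ (k.2 ∩ k'.2).card)⁻¹ := by
    simp_rw [Pi.pow_apply, count_eq_sum, sq, Finset.sum_mul_sum, Finset.mul_sum]
    rw [Finset.sum_comm]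
    refine Finset.sum_congr rfl fun k hk1 => ?_
    rw [Finset.sum_comm]
    refine Finset.sum_congr rfl fun k' hk2 => ?_
    have e1 : (k.2 ∪ k'.2).card + (k.2 ∩ k'.2).card = 2 * H.edgeFinset.card := by
      rw [Finset.card_union_add_card_inter, (hk k hk1).2, (hk k' hk2).2, two_mul]
    rw [← e1, pow_add, mul_assoc, mul_inv_cancel₀ (by positivity), mul_one,
      ← integral_indicator_superset]
    · refine Finset.sum_congr rfl fun Γ _ => ?_
      congr 1
      simp only [Finset.mem_union, or_imp, forall_and]
      by_cases h1 : ∀ e ∈ k.2, e ∈ Γ.edgeSet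
      · by_cases h2 : ∀ e ∈ k'.2, e ∈ Γ.edgeSet
        · rw [if_pos h1, if_pos h2, if_pos ⟨h1, h2⟩, mul_one]
        · rw [if_neg h2, if_neg (fun h : _ ∧ _ => h2 h.2), mul_zero]
      · rw [if_neg h1, if_neg (fun h : _ ∧ _ => h1 h.1), zero_mul]
    · intro e he
      rcases Finset.mem_union.1 he with he | he
      exacts [(hk k hk1).1 e he, (hk k' hk2).1 e he]
  rw [h2]
  have h3 : ((copyKeys H n).card * (p : ℝ) ^ H.edgeFinset.card) ^ 2
      = (p : ℝ) ^ (2 * H.edgeFinset.card) *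
        ∑ k ∈ copyKeys H n, ∑ k' ∈ copyKeys H n, (1 : ℝ) := by
    simp; ring
  rw [h3, ← mul_sub, ← Finset.sum_sub_distrib]
  simp_rw [← Finset.sum_sub_distrib]
  refine mul_le_mul_of_nonneg_left (Finset.sum_le_sum fun k _ => Finset.sum_le_sum fun k' _ => ?_)
    (by positivity)
  -- Edge-disjoint copies are uncorrelated; for the other pairs the subtracted 1 is dropped.
  split_ifs with h
  · linarith
  · rw [Finset.not_nonempty_iff_eq_empty.1 h]; simp

/-- Fix a copy k. The edges it shares with the image of ψ lie within the set A of vertices that ψ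
maps into k, and the hypothesis gives p^(-e(A)) ≤ n^|A| / y. The sum of n^|A| over all maps factors
over the vertices; v targets of weight n and at most n of weight 1 make each factor at most (v+1)n.
-/
theorem variance_upper (H : SimpleGraph V) {n : ℕ} {p : I} (hp : 0 < (p : ℝ)) {y : ℝ} (hy : 0 < y)
    (hn : 1 ≤ n)
    (hB : ∀ B : Finset V, B.Nonempty → y ≤ (n : ℝ) ^ B.card * (p : ℝ) ^ (edgesIn H B).card) :
    variance (count H n) (SimpleGraph.binomialRandom (Fin n) p) ≤
      (Fintype.card V + 1 : ℝ) ^ Fintype.card V *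
        ((n : ℝ) ^ Fintype.card V * (p : ℝ) ^ H.edgeFinset.card) ^ 2 / y := by
  have hn' : (1 : ℝ) ≤ n := by exact_mod_cast hn
  set v := Fintype.card V
  refine (variance_count_le H n hp).trans ?_
  have hrow : ∀ k ∈ copyKeys H n, (∑ k' ∈ copyKeys H n,
      if (k.2 ∩ k'.2).Nonempty then ((p : ℝ) ^ (k.2 ∩ k'.2).card)⁻¹ else 0)
      ≤ ((v + 1 : ℝ) * n) ^ v / y := by
    intro k hk
    obtain ⟨φ, -, rfl⟩ := Finset.mem_image.1 hk
    have hends : ∀ e ∈ (copyKey H φ).2, ∀ x ∈ e, x ∈ (copyKey H φ).1 := by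
      intro e he x hx
      simp only [copyKey, Finset.mem_map] at he ⊢
      obtain ⟨d, hd, rfl⟩ := he
      obtain ⟨u, -, rfl⟩ := Sym2.mem_map.1 hx
      exact ⟨u, Finset.mem_univ _, rfl⟩
    have hcard : (copyKey H φ).1.card = v := by simp [copyKey, v]
    generalize copyKey H φ = k at hends hcard ⊢
    have hterm : ∀ ψ : V ↪ Fin n, (if (k.2 ∩ (copyKey H ψ).2).Nonempty then
        ((p : ℝ) ^ (k.2 ∩ (copyKey H ψ).2).card)⁻¹ else 0)
        ≤ (∏ w, if ψ w ∈ k.1 then (n : ℝ) else 1) / y := by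
      intro ψ
      set A : Finset V := Finset.univ.filter fun w => ψ w ∈ k.1 with hA
      have hprod : (∏ w, if ψ w ∈ k.1 then (n : ℝ) else 1) = (n : ℝ) ^ A.card := by
        simp [Finset.prod_ite, hA]
      rw [hprod]
      split_ifs with h
      · have hsub : k.2 ∩ (copyKey H ψ).2 ⊆ (edgesIn H A).map ψ.sym2Map := by
          intro e he
          obtain ⟨he1, he2⟩ := Finset.mem_inter.1 he
          simp only [copyKey, Finset.mem_map] at he2
          obtain ⟨d, hd, rfl⟩ := he2
          refine Finset.mem_map_of_mem _ (Finset.mem_filter.2 ⟨hd, fun u hu => ?_⟩)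
          rw [hA, Finset.mem_filter]
          exact ⟨Finset.mem_univ _, hends _ he1 _ (Sym2.mem_map.2 ⟨u, hu, rfl⟩)⟩
        have hAne : A.Nonempty := by
          obtain ⟨e, he⟩ := h
          obtain ⟨d, hd, -⟩ := Finset.mem_map.1 (hsub he)
          induction d using Sym2.ind with | _ a b =>
          exact ⟨a, (Finset.mem_filter.1 hd).2 a (by simp)⟩
        have hle : (k.2 ∩ (copyKey H ψ).2).card ≤ (edgesIn H A).card := by
          have := Finset.card_le_card hsub
          rwa [Finset.card_map] at this
        have h1 := hB A hAne
        have h2 : (p : ℝ) ^ (edgesIn H A).card ≤ (p : ℝ) ^ (k.2 ∩ (copyKey H ψ).2).card :=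
          pow_le_pow_of_le_one p.2.1 p.2.2 hle
        rw [le_div_iff₀ hy, inv_mul_le_iff₀ (by positivity)]
        calc y ≤ _ := h1
          _ ≤ (n : ℝ) ^ A.card * (p : ℝ) ^ (k.2 ∩ (copyKey H ψ).2).card :=
              mul_le_mul_of_nonneg_left h2 (by positivity)
          _ = _ := mul_comm _ _
      · positivity
    calc (∑ k' ∈ copyKeys H n,
          if (k.2 ∩ k'.2).Nonempty then ((p : ℝ) ^ (k.2 ∩ k'.2).card)⁻¹ else 0)
        ≤ ∑ ψ : V ↪ Fin n, if (k.2 ∩ (copyKey H ψ).2).Nonempty then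
          ((p : ℝ) ^ (k.2 ∩ (copyKey H ψ).2).card)⁻¹ else 0 :=
          sum_image_le_of_nonneg Finset.univ (copyKey H)
            (fun k' => if (k.2 ∩ k'.2).Nonempty then ((p : ℝ) ^ (k.2 ∩ k'.2).card)⁻¹ else 0)
            (fun k' => by split_ifs <;> positivity)
      _ ≤ ∑ ψ : V ↪ Fin n, (∏ w, if ψ w ∈ k.1 then (n : ℝ) else 1) / y :=
          Finset.sum_le_sum fun ψ _ => hterm ψ
      _ = ∑ f ∈ Finset.univ.image (fun ψ : V ↪ Fin n => (ψ : V → Fin n)),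
          (∏ w, if f w ∈ k.1 then (n : ℝ) else 1) / y := by
          rw [Finset.sum_image fun a _ b _ h => DFunLike.coe_injective h]
      _ ≤ ∑ f : V → Fin n, (∏ w, if f w ∈ k.1 then (n : ℝ) else 1) / y :=
          Finset.sum_le_sum_of_subset_of_nonneg (Finset.subset_univ _) fun f _ _ =>
            div_nonneg (Finset.prod_nonneg fun w _ => by split_ifs <;> positivity) hy.le
      _ = (∏ w : V, ∑ i : Fin n, if i ∈ k.1 then (n : ℝ) else 1) / y := by
          rw [← Finset.sum_div]
          have e := Finset.prod_univ_sum (fun _ : V => (Finset.univ : Finset (Fin n)))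
            (fun _ i => if i ∈ k.1 then (n : ℝ) else 1)
          rw [Fintype.piFinset_univ] at e
          rw [e]
      _ ≤ ((v + 1 : ℝ) * n) ^ v / y := by
          rw [Finset.prod_const, Finset.card_univ]
          refine div_le_div_of_nonneg_right (pow_le_pow_left₀ ?_ ?_ _) hy.le
          · exact Finset.sum_nonneg fun i _ => by split_ifs <;> positivity
          · calc (∑ i : Fin n, if i ∈ k.1 then (n : ℝ) else 1)
                ≤ ∑ i : Fin n, ((if i ∈ k.1 then (n : ℝ) else 0) + 1) := by
                  refine Finset.sum_le_sum fun i _ => ?_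
                  split_ifs <;> linarith
              _ = (v + 1 : ℝ) * n := by
                  simp [Finset.sum_add_distrib, hcard]; ring
  calc _ ≤ (p : ℝ) ^ (2 * H.edgeFinset.card) *
        ∑ k ∈ copyKeys H n, ((v + 1 : ℝ) * n) ^ v / y :=
        mul_le_mul_of_nonneg_left (Finset.sum_le_sum hrow) (by positivity)
    _ = (p : ℝ) ^ (2 * H.edgeFinset.card) * ((copyKeys H n).card *
        (((v + 1 : ℝ) * n) ^ v / y)) := by simp
    _ ≤ (p : ℝ) ^ (2 * H.edgeFinset.card) * ((n : ℝ) ^ v * (((v + 1 : ℝ) * n) ^ v / y)) := by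
        gcongr
        exact_mod_cast card_copyKeys_le H n
    _ = _ := by rw [mul_pow]; ring

/-- The standard deviation is small compared to the mean. -/
theorem stdDev_sq_le (H : SimpleGraph V) {n : ℕ} {p : I} (hp : 0 < (p : ℝ)) {y : ℝ} (hy : 0 < y)
    (hV : 0 < Fintype.card V) (hn : Fintype.card V ≤ n)
    (hB : ∀ B : Finset V, B.Nonempty → y ≤ (n : ℝ) ^ B.card * (p : ℝ) ^ (edgesIn H B).card) :
    stdDev H n p ^ 2 ≤ (Fintype.card V + 1 : ℝ) ^ Fintype.card V *
      ((2 * Fintype.card V : ℝ) ^ Fintype.card V) ^ 2 * (mean H n p ^ 2 / y) := by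
  rw [stdDev, Real.sq_sqrt (variance_nonneg _ _)]
  refine (variance_upper H hp hy (hV.trans_le hn) hB).trans ?_
  have h1 := mean_lower H p hV le_rfl hn
  have hVr : (0 : ℝ) < Fintype.card V := by exact_mod_cast hV
  rw [inv_mul_le_iff₀ (by positivity)] at h1
  calc _ ≤ (Fintype.card V + 1 : ℝ) ^ Fintype.card V *
        ((2 * Fintype.card V : ℝ) ^ Fintype.card V * mean H n p) ^ 2 / y := by gcongr
    _ = _ := by ring

end Moments

/-! ### Quantitative and asymptotic tail bounds -/

section Tail

variable {V : Type u} {H : SimpleGraph V}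

theorem pos_of_one_le_omega (hm : 0 < maxDensity H) {n : ℕ} {p : I} (h : 1 ≤ omega H n p) :
    0 < (n : ℝ) ∧ 0 < (p : ℝ) := by
  have h0 : 0 < omega H n p := by linarith
  constructor
  · rcases (Nat.cast_nonneg (α := ℝ) n).eq_or_lt' with h | h
    · rw [omega, h, zero_mul] at h0; exact absurd h0 (lt_irrefl _)
    · exact h
  · rcases p.2.1.eq_or_lt' with h | h
    · rw [omega, h, Real.zero_rpow hm.ne', mul_zero] at h0; exact absurd h0 (lt_irrefl _)
    · exact h

theorem tailProb_anti (H : SimpleGraph V) (n : ℕ) (p : I) {a b : ℝ} (h : a ≤ b) :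
    tailProb H n p b ≤ tailProb H n p a :=
  measureReal_mono fun _ hΓ => h.trans hΓ

theorem tailProb_le_one (n : ℕ) (p : I) (a : ℝ) : tailProb H n p a ≤ 1 := measureReal_le_one

/-- The standard deviation is positive if the count exceeds twice its mean with positive
probability. -/
theorem stdDev_pos {H : SimpleGraph V} {n : ℕ} {p : I} (hm : 0 < mean H n p)
    (h : 0 < tailProb H n p (2 * mean H n p)) : 0 < stdDev H n p := by
  rw [stdDev, Real.sqrt_pos]
  refine lt_of_le_of_ne (variance_nonneg _ _) fun h0 => h.ne' ?_
  have h1 := (evariance_eq_zero_iff (μ := SimpleGraph.binomialRandom (Fin n) p)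
    (X := count H n) (measurable_of_finite _).aemeasurable).1
    (by rw [← MemLp.ofReal_variance_eq MemLp.of_discrete, ← h0, ENNReal.ofReal_zero])
  have h2 : SimpleGraph.binomialRandom (Fin n) p {Γ | 2 * mean H n p ≤ count H n Γ} = 0 := by
    refine measure_mono_null (fun Γ hΓ => ?_) (ae_iff.1 h1)
    intro hcon
    have h3 : count H n Γ = mean H n p := hcon
    have h4 : 2 * mean H n p ≤ count H n Γ := hΓ
    linarith
  rw [tailProb, measureReal_def, h2]
  rfl

/-- From an exponential lower bound for a tail probability to a bound for its logarithm. -/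
theorem neg_log_tailProb_bounds {n : ℕ} {p : I} {a y : ℝ} (h : Real.exp (-y) ≤ tailProb H n p a) :
    0 ≤ -Real.log (tailProb H n p a) ∧ -Real.log (tailProb H n p a) ≤ y := by
  have h0 : 0 < tailProb H n p a := (Real.exp_pos _).trans_le h
  refine ⟨neg_nonneg.2 (Real.log_nonpos h0.le (tailProb_le_one n p a)), ?_⟩
  have := Real.log_le_log (Real.exp_pos _) h
  rw [Real.log_exp] at this
  linarith

variable [Fintype V]

/-- Quantitative lower bound for the upper tail, with `x` copies of each petal. -/
theorem tailProb_lower {r : ℕ} {G K : Finset V} {l : V → Fin r} (hm : 0 < maxDensity H)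
    (hG : IsTight H G) (hK : IsTight H K) (hV : 0 < Fintype.card V)
    (hl : ∀ u v, H.Adj u v → u ∈ K → v ∈ K → u ∉ G → v ∉ G → l u = l v)
    (hsurj : ∀ i, ∃ u ∈ K, u ∉ G ∧ l u = i) {n x : ℕ} {p : I} (hω : 1 ≤ omega H n p) (hx : 0 < x)
    (hn : Fintype.card V * x ≤ n) {C : ℝ} (hC : 0 ≤ C)
    (hCx : C * 2 * (2 * Fintype.card V : ℝ) ^ Fintype.card V * omega H n p ^ K.card
      ≤ (x : ℝ) ^ r) :
    1 ≤ 4 * tailProb H n p (C * mean H n p) *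
      ((1 + 2 * Fintype.card V * x : ℝ) ^ (Fintype.card V * x) *
        (1 + 2 * Fintype.card V : ℝ) ^ Fintype.card V) := by
  obtain ⟨hn0, hp0⟩ := pos_of_one_le_omega hm hω
  set v := Fintype.card V
  -- Each of the v·x classes gets N positions. A blow-up vertex ranges over N of them, so an
  -- agreement weighs p^(-m)/N ≤ 2vx, the source of the x log x cost. A vertex outside `K` ranges
  -- over x·N ≥ n/(2v) positions, so it costs only a constant.
  set N := n / (v * x) with hN
  have hvx : 0 < v * x := Nat.mul_pos hV hx
  have hN1 : 1 ≤ N := (Nat.one_le_div_iff hvx).2 hn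
  have hNn : (n : ℝ) / (2 * (v * x : ℕ)) ≤ N := natDiv_lower hvx hn
  have hv1 : (1 : ℝ) ≤ v := by exact_mod_cast hV
  have hx1 : (1 : ℝ) ≤ x := by exact_mod_cast hx
  have hNr : (0 : ℝ) < N := by exact_mod_cast hN1
  have hxN : (n : ℝ) / (2 * v) ≤ (x * N : ℕ) := by
    push_cast at hNn ⊢
    rw [div_le_iff₀ (by positivity)] at hNn ⊢
    linarith
  obtain ⟨ι⟩ : Nonempty (V × Fin x × Fin N ↪ Fin n) := by
    refine Function.Embedding.nonempty_of_card_le ?_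
    simp only [Fintype.card_prod, Fintype.card_fin]
    calc v * (x * N) = v * x * N := by ring
      _ ≤ n := Nat.mul_div_le _ _
  have : Nonempty (Fin N) := ⟨⟨0, hN1⟩⟩
  set R := Fintype.card {u // u ∉ K} with hR
  have hRK : K.card + R = v := by
    rw [hR, Fintype.card_subtype_compl]
    have := Finset.card_le_univ K
    simp
    omega
  have hRv : R ≤ v := by omega
  have hee := card_edgesIn_add_card_edgesOut H K
  have hωK : omega H n p ^ K.card = (n : ℝ) ^ K.card * (p : ℝ) ^ (edgesIn H K).card := by
    rw [omega, mul_pow, ← Real.rpow_natCast ((p : ℝ) ^ _), ← Real.rpow_mul hp0.le, ← hK,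
      Real.rpow_natCast]
  have hmean : mean H n p ≤
      omega H n p ^ K.card * ((n : ℝ) ^ R * (p : ℝ) ^ (edgesOut H K).card) := by
    refine (mean_upper H n p).trans_eq ?_
    rw [hωK, ← hee, show Fintype.card V = K.card + R from hRK.symm, pow_add, pow_add]
    ring
  have hpow : (n : ℝ) ^ R ≤ (2 * v : ℝ) ^ v * ((x * N : ℕ) : ℝ) ^ R := by
    calc (n : ℝ) ^ R = (2 * v : ℝ) ^ R * ((n : ℝ) / (2 * v)) ^ R := by
          rw [← mul_pow]; congr 1; field_simp
      _ ≤ _ := by gcongr; linarith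
  have key := planting_bound (X := Fin x) (α := Fin N) hp0 hm.le ⟨0, hx⟩ card_edgesIn_le hG hK hl
    hsurj ι (a := C * mean H n p) ?_
  · have hP : 0 ≤ tailProb H n p (C * mean H n p) := measureReal_nonneg
    refine key.trans (mul_le_mul_of_nonneg_left ?_ (by positivity))
    simp only [Fintype.card_fin]
    have hq : (p : ℝ) ^ (-maxDensity H) ≤ n := by
      rw [Real.rpow_neg hp0.le, inv_le_iff_one_le_mul₀ (by positivity)]
      exact hω
    have h1 : (p : ℝ) ^ (-maxDensity H) / N ≤ 2 * v * x := by
      rw [div_le_iff₀ hNr]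
      push_cast at hNn
      rw [div_le_iff₀ (by positivity)] at hNn
      linarith
    have h2 : (p : ℝ) ^ (-maxDensity H) / (x * N : ℕ) ≤ 2 * v := by
      rw [div_le_iff₀ (by push_cast; positivity)]
      rw [div_le_iff₀ (by positivity)] at hxN
      linarith
    refine mul_le_mul (pow_le_pow_left₀ (by positivity) (by linarith) _) ?_ (by positivity)
      (by positivity)
    calc _ ≤ (1 + 2 * v : ℝ) ^ R := pow_le_pow_left₀ (by positivity) (by linarith) _
      _ ≤ _ := pow_le_pow_right₀ (by linarith) hRv
  -- In `hCx` the factor 2 pays for the halving in `planting_bound`, and (2v)^v for replacing n by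
  -- x·N at the vertices outside `K`.
  · simp only [Fintype.card_fin]
    calc C * mean H n p
        ≤ C * (omega H n p ^ K.card * ((n : ℝ) ^ R * (p : ℝ) ^ (edgesOut H K).card)) :=
          mul_le_mul_of_nonneg_left hmean hC
      _ ≤ C * (omega H n p ^ K.card * (((2 * v : ℝ) ^ v * ((x * N : ℕ) : ℝ) ^ R) *
          (p : ℝ) ^ (edgesOut H K).card)) := by gcongr
      _ = (C * 2 * (2 * v : ℝ) ^ v * omega H n p ^ K.card) * (((x * N : ℕ) : ℝ) ^ R *
          (p : ℝ) ^ (edgesOut H K).card / 2) := by ring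
      _ ≤ (x : ℝ) ^ r * (((x * N : ℕ) : ℝ) ^ R * (p : ℝ) ^ (edgesOut H K).card / 2) := by gcongr
      _ = _ := by ring

/-- Asymptotic lower bound for the upper tail. -/
theorem tailProb_lower_eventually {r : ℕ} (hr : 1 ≤ r) {G K : Finset V} {l : V → Fin r}
    (hm : 0 < maxDensity H) (hG : IsTight H G) (hK : IsTight H K) (hV : 0 < Fintype.card V)
    (hl : ∀ u v, H.Adj u v → u ∈ K → v ∈ K → u ∉ G → v ∉ G → l u = l v)
    (hsurj : ∀ i, ∃ u ∈ K, u ∉ G ∧ l u = i) {κ ε β : ℝ} (hκ : κ = K.card / r) (hε : 0 < ε)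
    (hβ : β * (κ + ε) ≤ 1 / 2) {p : ℕ → I}
    (hω : Tendsto (fun n => omega H n (p n)) atTop atTop)
    (hωβ : ∀ᶠ n : ℕ in atTop, omega H n (p n) ≤ (n : ℝ) ^ β) {C : ℝ} (hC : 0 ≤ C) :
    ∀ᶠ n : ℕ in atTop, Real.exp (-(omega H n (p n) ^ (κ + 3 * ε)))
      ≤ tailProb H n (p n) (C * mean H n (p n)) := by
  have hr0 : (0 : ℝ) < r := by exact_mod_cast hr
  have hκ0 : 0 ≤ κ := by rw [hκ]; positivity
  set v := Fintype.card V
  have hv1 : (1 : ℝ) ≤ v := by exact_mod_cast hV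
  set A : ℝ := Real.log 4 + 2 * v * (Real.log (1 + 4 * v) + (κ + ε) / ε)
    + v * Real.log (1 + 2 * v) with hA
  have hpow : ∀ {δ : ℝ}, 0 < δ → Tendsto (fun n => omega H n (p n) ^ δ) atTop atTop :=
    fun hδ => (tendsto_rpow_atTop hδ).comp hω
  have hsqrt : Tendsto (fun n : ℕ => (n : ℝ) ^ (1 / 2 : ℝ)) atTop atTop :=
    (tendsto_rpow_atTop (by norm_num)).comp tendsto_natCast_atTop_atTop
  filter_upwards [hω.eventually_ge_atTop 1, hωβ,
    (hpow (mul_pos hr0 hε)).eventually_ge_atTop (C * 2 * (2 * v : ℝ) ^ v),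
    (hpow hε).eventually_ge_atTop A, hsqrt.eventually_ge_atTop (2 * v)] with n h1 h2 h3 h4 h5
  set w := omega H n (p n) with hw
  have hw0 : 0 < w := by linarith
  have hn0 : (0 : ℝ) < n := (pos_of_one_le_omega hm h1).1
  have hn1 : (1 : ℝ) ≤ n := by exact_mod_cast Nat.one_le_iff_ne_zero.2 (by
    rintro rfl; simp at hn0)
  -- With x ≥ y one has x^r ≥ ω^(rε) ω^|K|, and the surplus ω^(rε) absorbs all constants. The
  -- condition on `β` keeps y ≤ √n, so that the blow-up fits.
  set y := w ^ (κ + ε) with hy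
  have hy1 : 1 ≤ y := Real.one_le_rpow h1 (by positivity)
  set x := ⌈y⌉₊ with hx
  have hyx : y ≤ x := Nat.le_ceil y
  have hxy : (x : ℝ) ≤ 2 * y := by
    have := Nat.ceil_lt_add_one (show 0 ≤ y by linarith)
    linarith
  have hx0 : 0 < x := Nat.ceil_pos.2 (by linarith)
  have hvxn : v * x ≤ n := by
    have hyn : y ≤ (n : ℝ) ^ (1 / 2 : ℝ) := by
      calc y ≤ ((n : ℝ) ^ β) ^ (κ + ε) := Real.rpow_le_rpow hw0.le h2 (by positivity)
        _ = (n : ℝ) ^ (β * (κ + ε)) := by rw [Real.rpow_mul hn0.le]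
        _ ≤ _ := Real.rpow_le_rpow_of_exponent_le hn1 hβ
    have : (v * x : ℝ) ≤ n := by
      calc (v * x : ℝ) ≤ v * (2 * (n : ℝ) ^ (1 / 2 : ℝ)) := by gcongr; linarith
        _ = (2 * v) * (n : ℝ) ^ (1 / 2 : ℝ) := by ring
        _ ≤ (n : ℝ) ^ (1 / 2 : ℝ) * (n : ℝ) ^ (1 / 2 : ℝ) := by gcongr
        _ = n := by rw [← Real.rpow_add hn0]; norm_num
    exact_mod_cast this
  have hmain := tailProb_lower hm hG hK hV hl hsurj h1 hx0 hvxn hC (by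
    calc C * 2 * (2 * v : ℝ) ^ v * w ^ K.card
        ≤ w ^ (r * ε) * w ^ (K.card : ℝ) := by
          rw [Real.rpow_natCast]; gcongr
      _ = y ^ r := by
          rw [← Real.rpow_add hw0, hy, ← Real.rpow_natCast, ← Real.rpow_mul hw0.le]
          congr 1
          rw [hκ]; field_simp; ring
      _ ≤ (x : ℝ) ^ r := by gcongr)
  set P := tailProb H n (p n) (C * mean H n (p n)) with hP
  set B : ℝ := (1 + 2 * v * x : ℝ) ^ (v * x) * (1 + 2 * v : ℝ) ^ v with hB
  have hB0 : 0 < B := by positivity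
  -- The cost is of order x log x: the exponent κ + ε comes from x, one further ε pays for the
  -- logarithm and one for the constant `A`.
  have hlog : Real.log (4 * B) ≤ w ^ (κ + 3 * ε) := by
    have e1 : Real.log (4 * B) = Real.log 4 + v * x * Real.log (1 + 2 * v * x)
        + v * Real.log (1 + 2 * v) := by
      rw [hB, Real.log_mul (by norm_num) (by positivity),
        Real.log_mul (by positivity) (by positivity), Real.log_pow, Real.log_pow]
      push_cast; ring
    have e2 : Real.log (1 + 2 * v * x) ≤ (Real.log (1 + 4 * v) + (κ + ε) / ε) * w ^ ε := by
      have hw1 : 1 ≤ w ^ ε := Real.one_le_rpow h1 hε.le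
      have h6 : Real.log w ≤ w ^ ε / ε := Real.log_le_rpow_div hw0.le hε
      have h7 : 0 ≤ Real.log (1 + 4 * v) := Real.log_nonneg (by linarith)
      calc Real.log (1 + 2 * v * x) ≤ Real.log ((1 + 4 * v) * y) := by
            refine Real.log_le_log (by positivity) ?_
            have : (v : ℝ) * x ≤ v * (2 * y) := by gcongr
            linarith
        _ = Real.log (1 + 4 * v) + (κ + ε) * Real.log w := by
            rw [Real.log_mul (by positivity) (by positivity), hy, Real.log_rpow hw0]
        _ ≤ Real.log (1 + 4 * v) * w ^ ε + (κ + ε) * (w ^ ε / ε) :=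
            add_le_add (le_mul_of_one_le_right h7 hw1)
              (mul_le_mul_of_nonneg_left h6 (by positivity))
        _ = _ := by ring
    have hw1 : 1 ≤ w ^ ε := Real.one_le_rpow h1 hε.le
    have h8 : 1 ≤ y * w ^ ε := one_le_mul_of_one_le_of_one_le hy1 hw1
    have h9 : 0 ≤ Real.log (1 + 2 * v) := Real.log_nonneg (by linarith)
    have h10 : (0 : ℝ) ≤ Real.log 4 := Real.log_nonneg (by norm_num)
    calc Real.log (4 * B) = _ := e1
      _ ≤ Real.log 4 * (y * w ^ ε) + v * (2 * y) *
          ((Real.log (1 + 4 * v) + (κ + ε) / ε) * w ^ ε)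
          + v * Real.log (1 + 2 * v) * (y * w ^ ε) := by
          refine add_le_add (add_le_add (le_mul_of_one_le_right h10 h8) ?_)
            (le_mul_of_one_le_right (by positivity) h8)
          refine mul_le_mul (by gcongr) e2 (Real.log_nonneg ?_) (by positivity)
          have : (0 : ℝ) ≤ 2 * v * x := by positivity
          linarith
      _ = A * (y * w ^ ε) := by rw [hA]; ring
      _ ≤ w ^ ε * (y * w ^ ε) := by gcongr
      _ = w ^ (κ + 3 * ε) := by
          rw [hy, ← Real.rpow_add hw0, ← Real.rpow_add hw0]; congr 1; ring
  have hPB : (4 * B)⁻¹ ≤ P := by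
    rw [inv_le_iff_one_le_mul₀ (by positivity)]
    linarith
  calc Real.exp (-(w ^ (κ + 3 * ε))) ≤ Real.exp (-Real.log (4 * B)) :=
        Real.exp_le_exp.2 (neg_le_neg hlog)
    _ = (4 * B)⁻¹ := by rw [Real.exp_neg, Real.exp_log (by positivity)]
    _ ≤ P := hPB

end Tail

/-! ### Comparison of powers of ω -/

section Asymptotics

theorem isLittleO_of_rpow_bounds {w f g : ℕ → ℝ} (hw : Tendsto w atTop atTop) {a b c : ℝ}
    (hab : a < b) (hc : 0 < c) (hf0 : ∀ᶠ n in atTop, 0 ≤ f n) (hf : ∀ᶠ n in atTop, f n ≤ w n ^ a)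
    (hg : ∀ᶠ n in atTop, c * w n ^ b ≤ g n) : f =o[atTop] g := by
  rw [isLittleO_iff]
  intro δ hδ
  have h1 : Tendsto (fun n => w n ^ (b - a)) atTop atTop :=
    (tendsto_rpow_atTop (sub_pos.2 hab)).comp hw
  filter_upwards [hf0, hf, hg, h1.eventually_ge_atTop (1 / (δ * c)), hw.eventually_gt_atTop 0]
    with n h0 h2 h3 h4 h5
  have h6 : 0 ≤ g n := le_trans (by positivity) h3
  rw [Real.norm_of_nonneg h0, Real.norm_of_nonneg h6]
  rw [div_le_iff₀ (by positivity)] at h4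
  calc f n ≤ w n ^ a := h2
    _ ≤ w n ^ a * (w n ^ (b - a) * (δ * c)) := le_mul_of_one_le_right (by positivity) h4
    _ = δ * (c * w n ^ b) := by
        rw [show w n ^ b = w n ^ a * w n ^ (b - a) by rw [← Real.rpow_add h5]; congr 1; ring]
        ring
    _ ≤ δ * g n := by gcongr

variable {V : Type u} [Fintype V] {H : SimpleGraph V}

/-- `M_H log (1/p)` and `Φ_H` are eventually at least a multiple of a power of `ω`. -/
theorem min_lower (hH : H.edgeSet.Nonempty) (hV : 0 < Fintype.card V) {s β : ℝ} (hs : 0 < s)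
    (hβ : β ≤ 1 / 2) {p : ℕ → I}
    (hω : Tendsto (fun n => omega H n (p n)) atTop atTop)
    (hωβ : ∀ᶠ n : ℕ in atTop, omega H n (p n) ≤ (n : ℝ) ^ β)
    (hωlog : ∀ᶠ n : ℕ in atTop, omega H n (p n) ^ s ≤ Real.log n)
    (hB : ∀ᶠ n : ℕ in atTop, ∀ B : Finset V, B.Nonempty →
      omega H n (p n) ^ s ≤ (n : ℝ) ^ B.card * (p n : ℝ) ^ (edgesIn H B).card) :
    ∃ c : ℝ, 0 < c ∧ ∀ᶠ n : ℕ in atTop, c * omega H n (p n) ^ s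
      ≤ min (Phi H n (p n)) (M H n (p n) * Real.log (1 / (p n : ℝ))) := by
  have hm := maxDensity_pos hH
  have hVr : (0 : ℝ) < Fintype.card V := by exact_mod_cast hV
  set c₁ : ℝ := ((2 * Fintype.card V : ℝ) ^ Fintype.card V)⁻¹ with hc₁
  have hc₁0 : 0 < c₁ := by positivity
  refine ⟨min c₁ (1 / (2 * maxDensity H)), by positivity, ?_⟩
  have hpow : Tendsto (fun n => omega H n (p n) ^ s) atTop atTop :=
    (tendsto_rpow_atTop hs).comp hω
  filter_upwards [hω.eventually_ge_atTop 1, hωβ, hωlog, hB, eventually_ge_atTop (Fintype.card V),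
    hpow.eventually_ge_atTop c₁⁻¹] with n h1 h2 h3 h4 h5 h6
  obtain ⟨hn0, hp0⟩ := pos_of_one_le_omega hm h1
  have hn1 : 1 ≤ n := hV.trans_le h5
  set w := omega H n (p n) with hw
  have hw0 : 0 < w := by linarith
  have hws : 0 ≤ w ^ s := by positivity
  refine le_min ?_ ?_
  · exact (mul_le_mul_of_nonneg_right (min_le_left _ _) hws).trans (Phi_lower hH h5 h4)
  -- As M_H ≥ 1, it is enough that log(1/p) = (log n - log ω)/m ≥ log n / (2m) ≥ ω^s / (2m).
  · have hM : 1 ≤ M H n (p n) := by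
      refine one_le_M hH hn1 fun F hF => le_trans ?_ (mean_subgraph_lower h5 h4 F hF)
      rwa [← hc₁, ← div_le_iff₀' hc₁0, one_div]
    have hlogp : Real.log (1 / (p n : ℝ)) = (Real.log n - Real.log w) / maxDensity H := by
      rw [hw, omega, Real.log_mul hn0.ne' (by positivity), Real.log_rpow hp0, one_div, Real.log_inv]
      field_simp
      ring
    have hlogw : Real.log w ≤ Real.log n / 2 := by
      have e1 : Real.log w ≤ β * Real.log n := by
        rw [← Real.log_rpow hn0]
        exact Real.log_le_log hw0 h2
      have e2 : 0 ≤ Real.log n := Real.log_natCast_nonneg n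
      nlinarith
    have hlow : 1 / (2 * maxDensity H) * w ^ s ≤ Real.log (1 / (p n : ℝ)) := by
      rw [hlogp, le_div_iff₀ hm]
      calc 1 / (2 * maxDensity H) * w ^ s * maxDensity H = w ^ s / 2 := by field_simp
        _ ≤ _ := by linarith
    calc _ ≤ 1 / (2 * maxDensity H) * w ^ s :=
          mul_le_mul_of_nonneg_right (min_le_right _ _) hws
      _ ≤ Real.log (1 / (p n : ℝ)) := hlow
      _ ≤ _ := le_mul_of_one_le_left (le_trans (by positivity) hlow) hM

theorem mean_pos (hV : 0 < Fintype.card V) {n : ℕ} {p : I} (hp : 0 < (p : ℝ))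
    (hn : Fintype.card V ≤ n) : 0 < mean H n p := by
  have hVr : (0 : ℝ) < Fintype.card V := by exact_mod_cast hV
  have hnr : (0 : ℝ) < n := by exact_mod_cast hV.trans_le hn
  exact lt_of_lt_of_le (by positivity) (mean_lower H p hV le_rfl hn)

end Asymptotics

end UpperTail

/-! ### Choice of the exponents and conclusion -/

theorem theorem3p1 {V : Type*} [Fintype V] (H : SimpleGraph V) (hH : H.edgeSet.Nonempty)
    (G : H.Subgraph) (hG : UpperTail.IsPrimal G)
    (r : ℕ) (hr : 1 ≤ r) (J : Fin r → H.Subgraph) (hJinj : Function.Injective J)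
    (hJ : ∀ i, UpperTail.IsPrimal (J i)) (hJG : ∀ i, UpperTail.Covers (J i) G)
    (hK : ∀ F : H.Subgraph, UpperTail.IsPrimal F →
      ((⨆ i, J i).verts.ncard : ℝ) / (r : ℝ) < (F.verts.ncard : ℝ)) :
    ∃ c : ℝ, 0 < c ∧ ∃ β : ℝ, 0 < β ∧
      (∀ ε : ℝ, 0 < ε → ∀ p : ℕ → I,
        Tendsto (fun n : ℕ => UpperTail.omega H n (p n)) atTop atTop →
        (fun n : ℕ => UpperTail.omega H n (p n)) =o[atTop] (fun n : ℕ => Real.log (n : ℝ) ^ c) →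
        (∀ᶠ n : ℕ in atTop,
          0 < UpperTail.tailProb H n (p n) ((1 + ε) * UpperTail.mean H n (p n))) ∧
        (fun n : ℕ =>
            -Real.log (UpperTail.tailProb H n (p n) ((1 + ε) * UpperTail.mean H n (p n))))
          =o[atTop]
          (fun n : ℕ =>
            min (UpperTail.Phi H n (p n)) (UpperTail.M H n (p n) * Real.log (1 / (p n : ℝ))))) ∧
      (∃ lam : ℕ → I → ℝ, ∀ p : ℕ → I,
        Tendsto (fun n : ℕ => UpperTail.omega H n (p n)) atTop atTop →
        (fun n : ℕ => UpperTail.omega H n (p n)) =o[atTop] (fun n : ℕ => (n : ℝ) ^ β) →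
        Tendsto (fun n : ℕ => lam n (p n)) atTop atTop ∧
        (fun n : ℕ => lam n (p n) * UpperTail.stdDev H n (p n))
          =o[atTop] (fun n : ℕ => UpperTail.mean H n (p n)) ∧
        ∀ t : ℕ → ℝ,
          (∀ᶠ n : ℕ in atTop, lam n (p n) * UpperTail.stdDev H n (p n) ≤ t n) →
          t =O[atTop] (fun n : ℕ => UpperTail.mean H n (p n)) →
          (∀ᶠ n : ℕ in atTop,
            0 < UpperTail.tailProb H n (p n) (UpperTail.mean H n (p n) + t n)) ∧
          (fun n : ℕ =>
              -Real.log (UpperTail.tailProb H n (p n) (UpperTail.mean H n (p n) + t n)))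
            =o[atTop]
            (fun n : ℕ => t n ^ 2 / UpperTail.stdDev H n (p n) ^ 2)) := by
  classical
  open UpperTail in
  have hm := maxDensity_pos hH
  have hV : 0 < Fintype.card V := by
    obtain ⟨u, -⟩ := hG.1
    exact Fintype.card_pos_iff.2 ⟨u⟩
  obtain ⟨l, hl, hsurj⟩ := exists_label hr hG hJinj hJ hJG
  set K := vertFinset (⨆ i, J i) with hKdef
  have hKt : IsTight H K := isTight_iSup hJ
  rw [ncard_verts, ← hKdef] at hK
  set κ : ℝ := K.card / r with hκ
  have hκ0 : 0 ≤ κ := by positivity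
  -- The least integer above κ is at most the order of every primal subgraph, since these orders are
  -- integers exceeding κ.
  obtain ⟨s, hs1, hκs, hsB⟩ : ∃ s : ℝ, 1 ≤ s ∧ κ < s ∧
      ∀ B : Finset V, B.Nonempty → IsTight H B → s ≤ B.card := by
    refine ⟨(⌊κ⌋₊ + 1 : ℕ), by exact_mod_cast Nat.le_add_left 1 _,
      by exact_mod_cast Nat.lt_floor_add_one κ, fun B hB hT => ?_⟩
    have h := hK _ (isPrimal_inducedOn hB hT)
    rw [ncard_verts, vertFinset_inducedOn] at h
    exact_mod_cast Nat.succ_le_of_lt ((Nat.floor_lt hκ0).2 h)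
  have hs0 : 0 < s := by linarith
  obtain ⟨β₀, hβ₀, hβB⟩ := exists_pow_le_expectation hm hs0 hsB
  -- The tail costs ω^(κ+3η), so one quarter of the gap between κ and s remains to spare.
  set η : ℝ := (s - κ) / 4 with hη
  have hη0 : 0 < η := by rw [hη]; linarith
  -- `β₀` serves the expectations; 1/(2s) keeps the blow-up smaller than n.
  set β : ℝ := min β₀ (1 / (2 * s)) with hβ
  have hβ0 : 0 < β := by positivity
  have hβs : β * s ≤ 1 / 2 := by
    calc β * s ≤ 1 / (2 * s) * s := mul_le_mul_of_nonneg_right (min_le_right _ _) hs0.le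
      _ = 1 / 2 := by field_simp
  have hβκ : β * (κ + η) ≤ 1 / 2 := by
    refine le_trans (mul_le_mul_of_nonneg_left ?_ hβ0.le) hβs
    rw [hη]; linarith
  have hβhalf : β ≤ 1 / 2 := by nlinarith
  have hκη : κ + 4 * η = s := by rw [hη]; ring
  have hexp : ∀ p : ℕ → I, Tendsto (fun n : ℕ => omega H n (p n)) atTop atTop →
      (∀ᶠ n : ℕ in atTop, omega H n (p n) ≤ (n : ℝ) ^ β) →
      ∀ᶠ n : ℕ in atTop, ∀ B : Finset V, B.Nonempty →
        omega H n (p n) ^ s ≤ (n : ℝ) ^ B.card * (p n : ℝ) ^ (edgesIn H B).card := by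
    intro p hω hωβ
    filter_upwards [hω.eventually_ge_atTop 1, hωβ, eventually_ge_atTop 1] with n h1 h2 h3
    refine hβB n (p n) h1 (h2.trans ?_)
    exact Real.rpow_le_rpow_of_exponent_le (by exact_mod_cast h3) (min_le_left _ _)
  -- The exponent 1/s turns the hypothesis of (a) into ω^s ≤ log n.
  refine ⟨1 / s, by positivity, β, hβ0, ?_, ?_⟩
  · intro ε hε p hω hlog
    have hωlog : ∀ᶠ n : ℕ in atTop, omega H n (p n) ≤ Real.log n ^ (1 / s) := by
      filter_upwards [hlog.bound one_pos, hω.eventually_ge_atTop 0] with n h1 h2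
      rwa [one_mul, Real.norm_of_nonneg h2,
        Real.norm_of_nonneg (Real.rpow_nonneg (Real.log_natCast_nonneg n) _)] at h1
    have hωβ : ∀ᶠ n : ℕ in atTop, omega H n (p n) ≤ (n : ℝ) ^ β := by
      have h := ((isLittleO_log_rpow_rpow_atTop (1 / s) hβ0).comp_tendsto
        tendsto_natCast_atTop_atTop).bound one_pos
      filter_upwards [h, hωlog] with n h1 h2
      simp only [Function.comp] at h1
      rw [one_mul, Real.norm_of_nonneg (Real.rpow_nonneg (Real.log_natCast_nonneg n) _),
        Real.norm_of_nonneg (by positivity)] at h1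
      exact h2.trans h1
    have hωs : ∀ᶠ n : ℕ in atTop, omega H n (p n) ^ s ≤ Real.log n := by
      filter_upwards [hωlog, hω.eventually_ge_atTop 0] with n h1 h2
      calc omega H n (p n) ^ s ≤ (Real.log n ^ (1 / s)) ^ s := Real.rpow_le_rpow h2 h1 hs0.le
        _ = Real.log n := by
            rw [one_div, Real.rpow_inv_rpow (Real.log_natCast_nonneg n) hs0.ne']
    have htail := tailProb_lower_eventually hr hm hG.isTight hKt hV hl hsurj hκ hη0 hβκ hω hωβ
      (C := 1 + ε) (by linarith)
    obtain ⟨c, hc, hmin⟩ := min_lower hH hV hs0 hβhalf hω hωβ hωs (hexp p hω hωβ)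
    refine ⟨htail.mono fun n h => (Real.exp_pos _).trans_le h, ?_⟩
    exact isLittleO_of_rpow_bounds hω (a := κ + 3 * η) (by linarith) hc
      (htail.mono fun n h => (neg_log_tailProb_bounds h).1)
      (htail.mono fun n h => (neg_log_tailProb_bounds h).2) hmin
  -- λ² = ω^(κ+7η/2) lies halfway between the tail cost ω^(κ+3η) and ω^s, the order of the lower
  -- bound for μ²/σ².
  · refine ⟨fun n p => omega H n p ^ ((κ + 7 / 2 * η) / 2), fun p hω hωo => ?_⟩
    have hωβ : ∀ᶠ n : ℕ in atTop, omega H n (p n) ≤ (n : ℝ) ^ β := by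
      filter_upwards [hωo.bound one_pos, hω.eventually_ge_atTop 0] with n h1 h2
      rwa [one_mul, Real.norm_of_nonneg h2, Real.norm_of_nonneg (by positivity)] at h1
    have hlamsq : ∀ {n : ℕ}, 1 ≤ omega H n (p n) →
        (omega H n (p n) ^ ((κ + 7 / 2 * η) / 2)) ^ 2 = omega H n (p n) ^ (κ + 7 / 2 * η) := by
      intro n h
      rw [← Real.rpow_natCast, ← Real.rpow_mul (by linarith)]
      congr 1; push_cast; ring
    refine ⟨(tendsto_rpow_atTop (by positivity)).comp hω, ?_, ?_⟩
    · rw [isLittleO_iff]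
      intro δ hδ
      set D : ℝ := (Fintype.card V + 1 : ℝ) ^ Fintype.card V *
        ((2 * Fintype.card V : ℝ) ^ Fintype.card V) ^ 2 with hD
      have hpow : Tendsto (fun n => omega H n (p n) ^ (η / 2)) atTop atTop :=
        (tendsto_rpow_atTop (by positivity)).comp hω
      filter_upwards [hω.eventually_ge_atTop 1, hexp p hω hωβ, eventually_ge_atTop (Fintype.card V),
        hpow.eventually_ge_atTop (D / δ ^ 2)] with n h1 h2 h3 h4
      obtain ⟨hn0, hp0⟩ := pos_of_one_le_omega hm h1
      have hmean := mean_pos (H := H) hV hp0 h3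
      have hsd := stdDev_sq_le H hp0 (Real.rpow_pos_of_pos (by linarith) s) hV h3 h2
      have hsd0 : 0 ≤ stdDev H n (p n) := Real.sqrt_nonneg _
      set w := omega H n (p n)
      have hw0 : 0 < w := by linarith
      rw [Real.norm_of_nonneg (by positivity), Real.norm_of_nonneg hmean.le]
      refine le_of_sq_le_sq ?_ (by positivity)
      rw [mul_pow, hlamsq h1, mul_pow]
      rw [div_le_iff₀ (by positivity)] at h4
      calc w ^ (κ + 7 / 2 * η) * stdDev H n (p n) ^ 2
          ≤ w ^ (κ + 7 / 2 * η) * (D * (mean H n (p n) ^ 2 / w ^ s)) := by gcongr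
        _ ≤ w ^ (κ + 7 / 2 * η) * (w ^ (η / 2) * δ ^ 2 * (mean H n (p n) ^ 2 / w ^ s)) := by gcongr
        _ = δ ^ 2 * mean H n (p n) ^ 2 * (w ^ (κ + 7 / 2 * η) * w ^ (η / 2) / w ^ s) := by ring
        _ = δ ^ 2 * mean H n (p n) ^ 2 := by
            rw [← Real.rpow_add hw0, show κ + 7 / 2 * η + η / 2 = s by linarith,
              div_self (by positivity), mul_one]
    · intro t ht htO
      obtain ⟨C, hC, hCt⟩ := htO.exists_pos
      have htail := tailProb_lower_eventually hr hm hG.isTight hKt hV hl hsurj hκ hη0 hβκ hω hωβ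
        (C := 1 + C) (by linarith)
      -- The tail at 2μ serves only to show σ > 0; for σ = 0 the quotient t²/σ² would take the value
      -- 0.
      have htail2 := tailProb_lower_eventually hr hm hG.isTight hKt hV hl hsurj hκ hη0 hβκ hω hωβ
        (C := 2) (by norm_num)
      have htail' : ∀ᶠ n : ℕ in atTop, Real.exp (-(omega H n (p n) ^ (κ + 3 * η)))
          ≤ tailProb H n (p n) (mean H n (p n) + t n) := by
        filter_upwards [htail, hCt.bound, hω.eventually_ge_atTop 1,
          eventually_ge_atTop (Fintype.card V)] with n h1 h2 h3 h4
        have hmean := mean_pos (H := H) hV (pos_of_one_le_omega hm h3).2 h4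
        refine h1.trans (tailProb_anti H n (p n) ?_)
        rw [Real.norm_of_nonneg hmean.le] at h2
        have := (Real.le_norm_self (t n)).trans h2
        linarith
      refine ⟨htail'.mono fun n h => (Real.exp_pos _).trans_le h, ?_⟩
      refine isLittleO_of_rpow_bounds hω (a := κ + 3 * η) (b := κ + 7 / 2 * η) (by linarith) one_pos
        (htail'.mono fun n h => (neg_log_tailProb_bounds h).1)
        (htail'.mono fun n h => (neg_log_tailProb_bounds h).2) ?_
      filter_upwards [ht, htail2, hω.eventually_ge_atTop 1,
        eventually_ge_atTop (Fintype.card V)] with n h1 h2 h3 h4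
      have hmean := mean_pos (H := H) hV (pos_of_one_le_omega hm h3).2 h4
      have hsd := stdDev_pos hmean ((Real.exp_pos _).trans_le h2)
      rw [one_mul, ← hlamsq h3, le_div_iff₀ (by positivity), ← mul_pow]
      exact pow_le_pow_left₀ (by positivity) h1 2
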